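/- Let $\mathcal X\subseteq\mathbb R^n$ be closed (not necessarily convex), $\mathcal Y\subseteq\mathbb R^p$ closed and convex, $\mathcal K\subseteq\mathbb R^m$ a closed convex cone with polar cone $\mathcal K^\circ=\{\lambda:\langle\lambda,z\rangle\le 0\ \text{for all } z\in\mathcal K\}$, and let $g:\mathbb R^n\times\mathbb R^p\to\mathbb R$, $r_1:\mathbb R^n\to\mathbb R$, $c:\mathbb R^n\times\mathbb R^p\to\mathbb R^m$ and $\mu>0$. Let $\mathcal T_S$ be the Clarke tangent cone of a set $S$, $\mathcal N_S$ its polar (the Clarke normal cone), $\partial f(x)$ the Clarke subdifferential (the convex hull of all limits of $\nabla f(z_k)$ along differentiability points $z_k\to x$), $\mathrm{ri}$ the relative interior, and $\mathrm{lin}(S)$ the largest linear subspace contained in $S$. Partial Jacobians are transposed: $\nabla_x c(x,y)\in\mathbb R^{n\times m}$ and $\nabla_y c(x,y)\in\mathbb R^{p\times m}$. Consider $$\text{(MCC)}\quad \min_{x\in\mathcal X}\Phi(x),\qquad \Phi(x)=\max_{y\in\mathcal Y,\ c(x,y)\in\mathcal K}\ g(x,y)+r_1(x),$$ $$\text{(MOL)}\quad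 \min_{x\in\mathcal X,\ \lambda\in\mathcal K^\circ}\ \max_{y\in\mathcal Y}\ g(x,y)+r_1(x)-\langle\lambda,c(x,y)\rangle .$$ Assume: 1. $g$ and $c$ are differentiable with locally Lipschitz derivative on an open set containing $\mathcal X\times\mathcal Y$, and $r_1$ is locally Lipschitz. 2. There is an open set $U\supseteq\mathcal X$ such that for every $x\in U$ the function $g(x,\cdot)$ is $\mu$-strongly concave on $\mathcal Y$, and $y\mapsto\langle\lambda,c(x,y)\rangle$ is convex on $\mathcal Y$ for every $\lambda\in\mathcal K^\circ$. 3. (Nondegeneracy) For all $x\in\mathcal X$ and $y\in\mathcal Y$ with $c(x,y)\in\mathcal K$, $$\mathbb R^{m+p}=\begin{bmatrix}\nabla_y c(x,y)^\top\\ I_p\end{bmatrix}\mathbb R^p+\mathrm{lin}\big(\mathcal T_{\mathcal K}(c(x,y))\times\mathcal T_{\mathcal Y}(y)\big).$$ 4. (Slater) For every $x\in\mathcal X$ there is $y\in\mathrm{ri}(\mathcal Y)$ with $c(x,y)\in\mathrm{ri}(\mathcal K)$. Call $(x,y)\in\mathcal X\times\mathcal Y$ a first-order minimax point of (MCC) if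 $0\in\partial\Phi(x)+\mathcal N_{\mathcal X}(x)$ and $y$ maximizes $g(x,\cdot)+r_1(x)$ over $\{y'\in\mathcal Y: c(x,y')\in\mathcal K\}$. Call $(x,\lambda,y)\in\mathcal X\times\mathcal K^\circ\times\mathcal Y$ a first-order minimax point of (MOL) if $$0\in\nabla_x g(x,y)-\nabla_x c(x,y)\lambda+\partial r_1(x)+\mathcal N_{\mathcal X}(x),\quad 0\in-\nabla_y g(x,y)+\nabla_y c(x,y)\lambda+\mathcal N_{\mathcal Y}(y),\quad 0\in-c(x,y)+\mathcal N_{\mathcal K^\circ}(\lambda).$$ Then for every first-order minimax point $(x,y)$ of (MCC) there is $\lambda\in\mathcal K^\circ$ such that $(x,\lambda,y)$ is a first-order minimax point of (MOL). Conversely, for every first-order minimax point $(x,\lambda,y)$ of (MOL), $(x,y)$ is a first-order minimax point of (MCC). -/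

import Mathlib

open Filter Topology
open scoped Pointwise

namespace MinimaxCoupled

noncomputable section

section Variational

variable {E : Type*} [NormedAddCommGroup E] [InnerProductSpace ℝ E]

/-- The polar cone `K° = {v | ⟪v, z⟫ ≤ 0 for all z ∈ K}`. -/
def polarCone (K : Set E) : Set E :=
  {v | ∀ z ∈ K, inner ℝ v z ≤ 0}

/-- The Clarke tangent cone of `S` at `x`: all `d` such that for every sequence `z k → x` in `S`
and every sequence `t k ↓ 0` there are `d k → d` with `z k + t k • d k ∈ S`. -/
def clarkeTangentCone (S : Set E) (x : E) : Set E :=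
  {d | ∀ (z : ℕ → E) (t : ℕ → ℝ), (∀ k, z k ∈ S) → Tendsto z atTop (𝓝 x) →
    (∀ k, 0 < t k) → Tendsto t atTop (𝓝 0) →
      ∃ e : ℕ → E, Tendsto e atTop (𝓝 d) ∧ ∀ k, z k + t k • e k ∈ S}

/-- The Clarke normal cone, the polar of the Clarke tangent cone. -/
def clarkeNormalCone (S : Set E) (x : E) : Set E :=
  polarCone (clarkeTangentCone S x)

/-- The Clarke subdifferential of a function on a finite-dimensional Euclidean space: the convex
hull of all limits of gradients along sequences of differentiability points tending to `x`. -/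
def clarkeSubdifferential [CompleteSpace E] (f : E → ℝ) (x : E) : Set E :=
  convexHull ℝ {v | ∃ z : ℕ → E, (∀ k, DifferentiableAt ℝ f (z k)) ∧
    Tendsto z atTop (𝓝 x) ∧ Tendsto (fun k => gradient f (z k)) atTop (𝓝 v)}

end Variational

/-- The largest linear subspace contained in `S` (meant for convex cones), as the union of all
linear subspaces contained in `S`. -/
def lin {V : Type*} [AddCommGroup V] [Module ℝ V] (S : Set V) : Set V :=
  {v | ∃ W : Submodule ℝ V, (W : Set V) ⊆ S ∧ v ∈ W}

/-- `f` is locally Lipschitz smooth over `S`: it is differentiable with locally Lipschitz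
derivative on an open set containing `S`. -/
def LocallyLipschitzSmoothOn {V W : Type*} [NormedAddCommGroup V] [NormedSpace ℝ V]
    [NormedAddCommGroup W] [NormedSpace ℝ W] (f : V → W) (S : Set V) : Prop :=
  ∃ O : Set V, IsOpen O ∧ S ⊆ O ∧ DifferentiableOn ℝ f O ∧ LocallyLipschitzOn O (fderiv ℝ f)

section Problem

variable {n m p : ℕ}

/-- The feasible set `{y ∈ Y | c(x, y) ∈ K}` of the inner maximization problem. -/
def feasibleSet (Y : Set (EuclideanSpace ℝ (Fin p))) (K : Set (EuclideanSpace ℝ (Fin m)))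
    (c : EuclideanSpace ℝ (Fin n) → EuclideanSpace ℝ (Fin p) → EuclideanSpace ℝ (Fin m))
    (x : EuclideanSpace ℝ (Fin n)) : Set (EuclideanSpace ℝ (Fin p)) :=
  {y | y ∈ Y ∧ c x y ∈ K}

/-- The value `Φ(x)` of the inner problem: maximize `φ(x, y) = g(x, y) + r₁(x)` over the
feasible `y`. -/
def innerValue (Y : Set (EuclideanSpace ℝ (Fin p))) (K : Set (EuclideanSpace ℝ (Fin m)))
    (g : EuclideanSpace ℝ (Fin n) → EuclideanSpace ℝ (Fin p) → ℝ)
    (r₁ : EuclideanSpace ℝ (Fin n) → ℝ)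
    (c : EuclideanSpace ℝ (Fin n) → EuclideanSpace ℝ (Fin p) → EuclideanSpace ℝ (Fin m))
    (x : EuclideanSpace ℝ (Fin n)) : ℝ :=
  sSup ((fun y => g x y + r₁ x) '' feasibleSet Y K c x)

/-- The set `y*(x)` of solutions of the inner problem. -/
def innerArgmax (Y : Set (EuclideanSpace ℝ (Fin p))) (K : Set (EuclideanSpace ℝ (Fin m)))
    (g : EuclideanSpace ℝ (Fin n) → EuclideanSpace ℝ (Fin p) → ℝ)
    (r₁ : EuclideanSpace ℝ (Fin n) → ℝ)
    (c : EuclideanSpace ℝ (Fin n) → EuclideanSpace ℝ (Fin p) → EuclideanSpace ℝ (Fin m))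
    (x : EuclideanSpace ℝ (Fin n)) : Set (EuclideanSpace ℝ (Fin p)) :=
  {y | y ∈ feasibleSet Y K c x ∧ IsMaxOn (fun y' => g x y' + r₁ x) (feasibleSet Y K c x) y}

/-- The standing assumptions on the problem with coupled constraints. The two convexity
conditions are asked for all `x` in a neighbourhood of `X`, so that the inner value function is
meaningful around the points of `X`, where its Clarke subdifferential is taken; the
nondegeneracy condition and the Slater condition are asked on `X` only. -/
structure StandingAssumptions (X : Set (EuclideanSpace ℝ (Fin n)))
    (Y : Set (EuclideanSpace ℝ (Fin p))) (K : Set (EuclideanSpace ℝ (Fin m)))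
    (g : EuclideanSpace ℝ (Fin n) → EuclideanSpace ℝ (Fin p) → ℝ)
    (r₁ : EuclideanSpace ℝ (Fin n) → ℝ)
    (c : EuclideanSpace ℝ (Fin n) → EuclideanSpace ℝ (Fin p) → EuclideanSpace ℝ (Fin m))
    (μ : ℝ) : Prop where
  g_smooth : LocallyLipschitzSmoothOn (Function.uncurry g) (X ×ˢ Y)
  r₁_lipschitz : LocallyLipschitz r₁
  g_strongConcave : ∀ᶠ x in 𝓝ˢ X, StrongConcaveOn Y μ (g x)
  c_smooth : LocallyLipschitzSmoothOn (Function.uncurry c) (X ×ˢ Y)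
  c_convex : ∀ᶠ x in 𝓝ˢ X, ∀ l ∈ polarCone K, ConvexOn ℝ Y (fun y => inner ℝ l (c x y))
  nondegenerate : ∀ x ∈ X, ∀ y ∈ Y, c x y ∈ K →
    (Set.univ : Set (EuclideanSpace ℝ (Fin m) × EuclideanSpace ℝ (Fin p))) =
      Set.range (fun d : EuclideanSpace ℝ (Fin p) => (fderiv ℝ (c x) y d, d)) +
        lin (clarkeTangentCone K (c x y) ×ˢ clarkeTangentCone Y y)
  slater : ∀ x ∈ X, ∃ y ∈ Y, y ∈ intrinsicInterior ℝ Y ∧ c x y ∈ intrinsicInterior ℝ K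

/-- First-order minimax points `(x, y)` of
`min_{x ∈ X} max_{y ∈ Y, c(x, y) ∈ K} g(x, y) + r₁(x)`. -/
def IsFirstOrderMinimaxMCC (X : Set (EuclideanSpace ℝ (Fin n)))
    (Y : Set (EuclideanSpace ℝ (Fin p))) (K : Set (EuclideanSpace ℝ (Fin m)))
    (g : EuclideanSpace ℝ (Fin n) → EuclideanSpace ℝ (Fin p) → ℝ)
    (r₁ : EuclideanSpace ℝ (Fin n) → ℝ)
    (c : EuclideanSpace ℝ (Fin n) → EuclideanSpace ℝ (Fin p) → EuclideanSpace ℝ (Fin m))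
    (x : EuclideanSpace ℝ (Fin n)) (y : EuclideanSpace ℝ (Fin p)) : Prop :=
  x ∈ X ∧ y ∈ Y ∧
  0 ∈ clarkeSubdifferential (innerValue Y K g r₁ c) x + clarkeNormalCone X x ∧
  y ∈ innerArgmax Y K g r₁ c x

/-- First-order minimax points `(x, l, y)` of
`min_{x ∈ X, l ∈ K°} max_{y ∈ Y} g(x, y) + r₁(x) - ⟪l, c(x, y)⟫`. The adjoint of a partial
derivative of `c` is multiplication by the partial Jacobian in the transposed convention. -/
def IsFirstOrderMinimaxMOL (X : Set (EuclideanSpace ℝ (Fin n)))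
    (Y : Set (EuclideanSpace ℝ (Fin p))) (K : Set (EuclideanSpace ℝ (Fin m)))
    (g : EuclideanSpace ℝ (Fin n) → EuclideanSpace ℝ (Fin p) → ℝ)
    (r₁ : EuclideanSpace ℝ (Fin n) → ℝ)
    (c : EuclideanSpace ℝ (Fin n) → EuclideanSpace ℝ (Fin p) → EuclideanSpace ℝ (Fin m))
    (x : EuclideanSpace ℝ (Fin n)) (l : EuclideanSpace ℝ (Fin m))
    (y : EuclideanSpace ℝ (Fin p)) : Prop :=
  x ∈ X ∧ l ∈ polarCone K ∧ y ∈ Y ∧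
  0 ∈ {gradient (fun x' => g x' y) x -
        ContinuousLinearMap.adjoint (fderiv ℝ (fun x' => c x' y) x) l} +
      clarkeSubdifferential r₁ x + clarkeNormalCone X x ∧
  0 ∈ {-gradient (g x) y + ContinuousLinearMap.adjoint (fderiv ℝ (c x) y) l} +
      clarkeNormalCone Y y ∧
  0 ∈ {-c x y} + clarkeNormalCone (polarCone K) l

end Problem

end

end MinimaxCoupled

/-! Fix `x` and a solution `y` of the inner problem, which is unique by strong concavity.
Nondegeneracy forces any two Lagrange multipliers at `y` to agree. Applied to the zero objective, it
also yields a dual Slater condition near `y`, which persists uniformly for nearby `x'` and gives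
existence and boundedness of multipliers there. Compactness and uniqueness then make solutions and
multipliers converge as `x' → x` (`exists_tendsto_solution_multiplier`).

Comparing the solution at one parameter with the multiplier at another shows that `Φ - r₁` is
strictly differentiable at `x`, with gradient `∇ₓg - ∇ₓc λ` (`hasStrictFDerivAt_envelope`). For a
strictly differentiable summand the Clarke sum rule is an equality, so `∂Φ(x) = ∇ₓg - ∇ₓc λ +
∂r₁(x)`, and the two stationarity conditions in `x` are the same. The remaining conditions of (MOL)
are the KKT conditions of the inner problem. Conversely, since the Lagrangian is concave in `y`, KKT
makes `y` optimal and `λ` a multiplier, hence the unique one.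

Smoothness is available only near `X × Y`, so duality is run on a ball around `y`; concavity turns
local maxima into global ones. -/

namespace MinimaxCoupled

/-! ### Convex hulls and a mean value inequality for Lipschitz functions -/

section ClarkeCalculus

open MeasureTheory

/-- By Carathéodory, `finrank + 1` points suffice, so the hull is a continuous image of a simplex
times a power of `s`. -/
theorem isCompact_convexHull_of_finiteDimensional {E : Type*} [NormedAddCommGroup E]
    [NormedSpace ℝ E] [FiniteDimensional ℝ E] {s : Set E} (hs : IsCompact s) :
    IsCompact (convexHull ℝ s) := by
  rcases s.eq_empty_or_nonempty with rfl | ⟨z₀, hz₀⟩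
  · simp
  let κ := Fin (Module.finrank ℝ E + 1)
  have hcont : Continuous fun q : (κ → ℝ) × (κ → E) => ∑ i, q.1 i • q.2 i := by fun_prop
  have hcomp : IsCompact ((fun q : (κ → ℝ) × (κ → E) => ∑ i, q.1 i • q.2 i) ''
      (stdSimplex ℝ κ ×ˢ Set.univ.pi fun _ => s)) :=
    ((isCompact_stdSimplex ℝ κ).prod (isCompact_univ_pi fun _ => hs)).image hcont
  convert hcomp
  apply Set.Subset.antisymm
  · intro x hx
    obtain ⟨ι, _, z, w, hz, hind, hw, hw1, hsum⟩ := eq_pos_convex_span_of_mem_convexHull hx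
    have hcard : Fintype.card ι ≤ Fintype.card κ := by
      refine hind.card_le_finrank_succ.trans ?_
      simpa [κ] using Submodule.finrank_le (vectorSpan ℝ (Set.range z))
    obtain ⟨e⟩ := Function.Embedding.nonempty_of_card_le hcard
    -- Unused slots get weight zero and the dummy point `z₀`, which keeps the family inside `s`.
    refine ⟨(Function.extend e w 0, Function.extend e z fun _ => z₀), ⟨⟨?_, ?_⟩, ?_⟩, ?_⟩
    · intro j
      by_cases hj : ∃ i, e i = j
      · obtain ⟨i, rfl⟩ := hj
        simpa [e.injective.extend_apply] using (hw i).le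
      · simp [Function.extend_apply' _ _ _ hj]
    · rw [← hw1]
      refine (Fintype.sum_of_injective e e.injective _ _ (fun j hj => ?_) fun i => ?_).symm
      · simp [Function.extend_apply' _ _ _ hj]
      · simp [e.injective.extend_apply]
    · intro j _
      by_cases hj : ∃ i, e i = j
      · obtain ⟨i, rfl⟩ := hj
        simpa [e.injective.extend_apply] using hz ⟨i, rfl⟩
      · simpa [Function.extend_apply' _ _ _ hj] using hz₀
    · rw [← hsum]
      refine (Fintype.sum_of_injective e e.injective _ _ (fun j hj => ?_) fun i => ?_).symm
      · simp [Function.extend_apply' _ _ _ hj]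
      · simp [e.injective.extend_apply]
  · rintro _ ⟨⟨w, z⟩, ⟨⟨hw, hw1⟩, hz⟩, rfl⟩
    exact (convex_convexHull ℝ s).sum_mem (fun i _ => hw i) hw1
      fun i _ => subset_convexHull ℝ s (hz i trivial)

/-- A mean value inequality for Lipschitz functions: a slope along a segment is nearly attained by
the derivative at a point of differentiability arbitrarily close to the segment. -/
theorem exists_differentiableAt_lt_fderiv {E : Type*} [NormedAddCommGroup E] [NormedSpace ℝ E]
    [FiniteDimensional ℝ E] {C : NNReal} {f : E → ℝ} (hf : LipschitzWith C f) {a u : E} {t α δ : ℝ}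
    (ht : 0 < t) (hδ : 0 < δ) (h : t * α < f (a + t • u) - f a) :
    ∃ s ∈ Set.Icc 0 t, ∃ w, dist w (a + s • u) < δ ∧ DifferentiableAt ℝ f w ∧
      α < fderiv ℝ f w u := by
  borelize E
  obtain ⟨δ', hδ', hδ'δ, hslack⟩ : ∃ δ' > 0, δ' ≤ δ ∧ ∀ y ∈ Metric.ball (0 : E) δ',
      t * α < f (a + t • u + y) - f (a + y) := by
    have hc : Continuous fun y : E => f (a + t • u + y) - f (a + y) := by
      have := hf.continuous
      fun_prop
    have : ∀ᶠ y in 𝓝 (0 : E), t * α < f (a + t • u + y) - f (a + y) :=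
      hc.continuousAt.eventually_const_lt (by simpa using h)
    obtain ⟨ε, hε, hb⟩ := Metric.eventually_nhds_iff_ball.1 this
    exact ⟨min ε δ, lt_min hε hδ, min_le_right _ _,
      fun y hy => hb y (Metric.ball_subset_ball (min_le_left _ _) hy)⟩
  -- Average over small translates of the segment. By Rademacher the averaged function is
  -- differentiable in `s`, with the averaged derivative; the classical mean value theorem equates
  -- this somewhere with a slope exceeding `α`, although every integrand is at most `α`.
  by_contra! hcon
  let μ : Measure E := Measure.addHaar
  let B := Metric.ball (0 : E) δ'
  have hμB : μ B ≠ ⊤ := measure_ball_lt_top.ne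
  have hμB0 : 0 < μ B := Metric.measure_ball_pos μ _ hδ'
  have : IsFiniteMeasure (μ.restrict B) := ⟨by simpa using hμB.lt_top⟩
  have hint : ∀ b : E, Integrable (fun y => f (b + y)) (μ.restrict B) := fun b => by
    have hc : Continuous fun y => f (b + y) := by
      have := hf.continuous
      fun_prop
    exact (hc.continuousOn.integrableOn_compact (isCompact_closedBall (0 : E) δ')).mono_set
      Metric.ball_subset_closedBall
  have hder : ∀ s : ℝ, HasDerivAt (fun s => ∫ y in B, f (a + s • u + y) ∂μ)
      (∫ y in B, fderiv ℝ f (a + s • u + y) u ∂μ) s := by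
    intro s
    have hae : ∀ᵐ y ∂μ, DifferentiableAt ℝ f (a + s • u + y) :=
      (quasiMeasurePreserving_add_left μ (a + s • u)).ae
        (hf.ae_differentiableAt (μ := μ))
    refine (hasDerivAt_integral_of_dominated_loc_of_lip (μ := μ.restrict B)
      (F := fun s y => f (a + s • u + y)) (bound := fun _ => C * ‖u‖) (s := Set.univ)
      univ_mem ?_ (hint (a + s • u)) ?_ ?_
      (integrable_const _) ?_).2
    · exact Eventually.of_forall fun s => (hint _).aestronglyMeasurable
    · exact ((measurable_fderiv_apply_const ℝ f u).comp
        (measurable_const_add _)).aestronglyMeasurable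
    · refine Eventually.of_forall fun y => LipschitzOnWith.of_dist_le_mul fun s₁ _ s₂ _ => ?_
      refine (hf.dist_le_mul _ _).trans ?_
      rw [Real.coe_nnabs, abs_of_nonneg (by positivity), mul_assoc]
      gcongr
      rw [dist_add_right, dist_add_left, dist_eq_norm, ← sub_smul, norm_smul, dist_eq_norm,
        mul_comm]
    · refine (ae_restrict_of_ae hae).mono fun y hy => ?_
      have h1 : HasDerivAt (fun s : ℝ => a + s • u + y) u s := by
        simpa using (((hasDerivAt_id s).smul_const u).const_add a).add_const y
      exact hy.hasFDerivAt.comp_hasDerivAt s h1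
  obtain ⟨s, hs, hslope⟩ := exists_hasDerivAt_eq_slope _ _ ht
    (fun s _ => (hder s).continuousAt.continuousWithinAt) (fun s _ => hder s)
  have hle : ∫ y in B, fderiv ℝ f (a + s • u + y) u ∂μ ≤ ∫ y in B, α ∂μ := by
    have hae : ∀ᵐ y ∂μ, DifferentiableAt ℝ f (a + s • u + y) :=
      (quasiMeasurePreserving_add_left μ (a + s • u)).ae
        (hf.ae_differentiableAt (μ := μ))
    refine integral_mono_ae ?_ (integrable_const _) ?_
    · refine Integrable.of_bound (C := C * ‖u‖) ((measurable_fderiv_apply_const ℝ f u).comp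
        (measurable_const_add _)).aestronglyMeasurable (Eventually.of_forall fun y => ?_)
      refine (ContinuousLinearMap.le_opNorm _ _).trans ?_
      gcongr
      exact norm_fderiv_le_of_lipschitz ℝ hf
    · filter_upwards [ae_restrict_of_ae hae, ae_restrict_mem measurableSet_ball] with y hy hyB
      refine hcon s ⟨hs.1.le, hs.2.le⟩ _ ?_ hy
      rw [dist_eq_norm]
      simpa using (mem_ball_zero_iff.1 hyB).trans_le hδ'δ
  have hsub : Integrable (fun y => f (a + t • u + y) - f (a + y)) (μ.restrict B) :=
    (hint _).sub (hint _)
  have hlt : ∫ y in B, t * α ∂μ < ∫ y in B, (f (a + t • u + y) - f (a + y)) ∂μ := by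
    rw [← sub_pos, ← integral_sub hsub (integrable_const _),
      setIntegral_pos_iff_support_of_nonneg_ae]
    · refine hμB0.trans_le (measure_mono fun y hy => ⟨?_, hy⟩)
      exact (sub_pos.2 (hslack y hy)).ne'
    · filter_upwards [ae_restrict_mem measurableSet_ball] with y hy
      exact (sub_pos.2 (hslack y hy)).le
    · exact hsub.sub (integrable_const _)
  rw [integral_sub (hint _) (hint _)] at hlt
  rw [hslope, sub_zero, div_le_iff₀ ht] at hle
  simp only [integral_const, smul_eq_mul, zero_smul, add_zero] at hlt hle
  linarith

end ClarkeCalculus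

/-! ### Sum rule for the Clarke subdifferential -/

section ClarkeSum

variable {E : Type*} [NormedAddCommGroup E] [InnerProductSpace ℝ E] [CompleteSpace E]

theorem inner_gradient_left (f : E → ℝ) (x u : E) : inner ℝ (gradient f x) u = fderiv ℝ f x u := by
  simp [gradient]

theorem norm_gradient (f : E → ℝ) (x : E) : ‖gradient f x‖ = ‖fderiv ℝ f x‖ := by
  simp [gradient]

/-- The limits of gradients of `f` along sequences of differentiability points tending to `x`. -/
def limitingGradients (f : E → ℝ) (x : E) : Set E :=
  {v | ∃ z : ℕ → E, (∀ k, DifferentiableAt ℝ f (z k)) ∧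
    Tendsto z atTop (𝓝 x) ∧ Tendsto (fun k => gradient f (z k)) atTop (𝓝 v)}

theorem mem_limitingGradients_iff {f : E → ℝ} {x v : E} :
    v ∈ limitingGradients f x ↔
      ∀ ε > 0, ∃ z, DifferentiableAt ℝ f z ∧ dist z x < ε ∧ dist (gradient f z) v < ε := by
  constructor
  · rintro ⟨z, hz, hzx, hzv⟩ ε hε
    obtain ⟨k, hk₁, hk₂⟩ := ((Metric.tendsto_nhds.1 hzx ε hε).and
      (Metric.tendsto_nhds.1 hzv ε hε)).exists
    exact ⟨z k, hz k, hk₁, hk₂⟩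
  · intro h
    choose z hz hzx hzv using fun k : ℕ => h (1 / ((k : ℝ) + 1)) Nat.one_div_pos_of_nat
    refine ⟨z, hz, ?_, ?_⟩ <;> rw [tendsto_iff_dist_tendsto_zero]
    · exact squeeze_zero (fun _ => dist_nonneg) (fun k => (hzx k).le)
        tendsto_one_div_add_atTop_nhds_zero_nat
    · exact squeeze_zero (fun _ => dist_nonneg) (fun k => (hzv k).le)
        tendsto_one_div_add_atTop_nhds_zero_nat

theorem isClosed_limitingGradients (f : E → ℝ) (x : E) : IsClosed (limitingGradients f x) := by
  refine isClosed_of_closure_subset fun v hv => mem_limitingGradients_iff.2 fun ε hε => ?_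
  obtain ⟨w, hw, hvw⟩ := Metric.mem_closure_iff.1 hv (ε / 2) (half_pos hε)
  obtain ⟨z, hz, hzx, hzw⟩ := mem_limitingGradients_iff.1 hw (ε / 2) (half_pos hε)
  refine ⟨z, hz, hzx.trans (half_lt_self hε), ?_⟩
  have := dist_triangle (gradient f z) w v
  rw [dist_comm w v] at this
  linarith

theorem isCompact_limitingGradients [FiniteDimensional ℝ E] {f : E → ℝ} {x : E} {C : NNReal}
    {N : Set E} (hN : N ∈ 𝓝 x) (hf : LipschitzOnWith C f N) :
    IsCompact (limitingGradients f x) := by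
  refine (isCompact_closedBall (0 : E) C).of_isClosed_subset (isClosed_limitingGradients f x) ?_
  rintro v ⟨z, -, hzx, hzv⟩
  rw [mem_closedBall_zero_iff]
  refine le_of_tendsto hzv.norm ?_
  filter_upwards [hzx.eventually (eventually_mem_nhds_iff.2 hN)] with k hk
  rw [norm_gradient]
  exact norm_fderiv_le_of_lipschitzOn ℝ hk hf

/-- If `f - r` is strictly differentiable at `x`, then near `x` the function `r` has slopes along
`u` that almost match those of the limiting gradients of `f`. -/
theorem exists_gradient_inner_gt [FiniteDimensional ℝ E] {f r : E → ℝ} {x a v u : E} {C : NNReal}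
    {N : Set E} (hN : N ∈ 𝓝 x) (hr : LipschitzOnWith C r N)
    (hfr : HasStrictFDerivAt (fun z => f z - r z) (innerSL ℝ a) x)
    (hv : v ∈ limitingGradients f x) {α δ : ℝ} (hα : α < inner ℝ (v - a) u) (hδ : 0 < δ) :
    ∃ w, dist w x < δ ∧ DifferentiableAt ℝ r w ∧ α < inner ℝ (gradient r w) u := by
  -- Three losses of `η`: replacing `v` by a gradient of `f`, that gradient by a difference
  -- quotient, and `f` by `r` up to the linear part.
  obtain ⟨η, hη, hηα⟩ : ∃ η > 0, α + 3 * η < inner ℝ (v - a) u :=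
    ⟨(inner ℝ (v - a) u - α) / 4, by linarith, by linarith⟩
  obtain ⟨ε, hε, hεu⟩ : ∃ ε > 0, ε * ‖u‖ ≤ η :=
    ⟨η / (‖u‖ + 1), by positivity, by
      rw [div_mul_eq_mul_div, div_le_iff₀ (by positivity)]
      nlinarith [norm_nonneg u]⟩
  have hstrict := hfr.isLittleO.def hε
  rw [nhds_prod_eq] at hstrict
  obtain ⟨δ', hδ', hδδ', hsub, hbd⟩ : ∃ δ' > 0, δ' ≤ δ ∧ Metric.ball x δ' ⊆ N ∧
      ∀ z ∈ Metric.ball x δ', ∀ w ∈ Metric.ball x δ',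
        |f w - r w - (f z - r z) - inner ℝ a (w - z)| ≤ ε * ‖w - z‖ := by
    obtain ⟨δ₁, hδ₁, h₁⟩ := Metric.mem_nhds_iff.1 hN
    obtain ⟨s, hs, h₂⟩ := eventually_prod_self_iff'.1 hstrict
    obtain ⟨δ₂, hδ₂, h₃⟩ := Metric.mem_nhds_iff.1 hs
    refine ⟨min δ (min δ₁ δ₂), by positivity, min_le_left _ _,
      (Metric.ball_subset_ball ((min_le_right _ _).trans (min_le_left _ _))).trans h₁, ?_⟩
    have h₄ := (Metric.ball_subset_ball (x := x) ((min_le_right δ (min δ₁ δ₂)).trans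
      (min_le_right _ _))).trans h₃
    intro z hz w hw
    simpa using h₂ w (h₄ hw) z (h₄ hz)
  -- The mean value inequality needs a globally Lipschitz function; `r'` agrees with `r` on `N`.
  obtain ⟨r', hr', heq⟩ := hr.extend_real
  obtain ⟨z, hzd, hzx, hzv⟩ : ∃ z, DifferentiableAt ℝ f z ∧ dist z x < δ' / 3 ∧
      inner ℝ v u - η < inner ℝ (gradient f z) u := by
    obtain ⟨z, hz, hzx, hzv⟩ := hv
    have h₁ : Tendsto (fun k => inner ℝ (gradient f (z k)) u) atTop (𝓝 (inner ℝ v u)) :=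
      hzv.inner tendsto_const_nhds
    obtain ⟨k, hk₁, hk₂⟩ := ((Metric.tendsto_nhds.1 hzx (δ' / 3) (by positivity)).and
      (h₁.eventually_const_lt (sub_lt_self _ hη))).exists
    exact ⟨z k, hz k, hk₁, hk₂⟩
  obtain ⟨t, ht, htu, hft⟩ : ∃ t > 0, t * ‖u‖ < δ' / 3 ∧
      t * (inner ℝ (gradient f z) u - η) < f (z + t • u) - f z := by
    have hd : HasDerivAt (fun t : ℝ => f (z + t • u)) (inner ℝ (gradient f z) u) 0 := by
      have h1 : HasDerivAt (fun s : ℝ => z + s • u) u 0 := by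
        simpa using ((hasDerivAt_id (0 : ℝ)).smul_const u).const_add z
      rw [inner_gradient_left]
      refine HasFDerivAt.comp_hasDerivAt (x := (0 : ℝ)) (f := fun s : ℝ => z + s • u) ?_ h1
      simpa using hzd.hasFDerivAt
    have h₁ := (hasDerivAt_iff_tendsto_slope_zero.1 hd).mono_left
      (nhdsWithin_mono (0 : ℝ) fun t (ht : 0 < t) => ht.ne')
    have h₂ : Tendsto (fun t : ℝ => t * ‖u‖) (𝓝[>] 0) (𝓝 0) := by
      have : Continuous fun t : ℝ => t * ‖u‖ := by fun_prop
      simpa using (this.tendsto 0).mono_left nhdsWithin_le_nhds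
    obtain ⟨t, ht₀, ht₁, ht₂⟩ := ((eventually_mem_nhdsWithin (a := (0 : ℝ)) (s := Set.Ioi 0)).and
      ((h₁.eventually_const_lt (sub_lt_self _ hη)).and
      (h₂.eventually_lt_const (show 0 < δ' / 3 by positivity)))).exists
    have ht₀ : 0 < t := ht₀
    refine ⟨t, ht₀, ht₂, ?_⟩
    simp only [zero_add, zero_smul, add_zero, smul_eq_mul] at ht₁
    rwa [inv_mul_eq_div, lt_div_iff₀ ht₀, mul_comm] at ht₁
  have hz_ball : z ∈ Metric.ball x δ' := by
    rw [Metric.mem_ball]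
    linarith
  have hball : ∀ s ∈ Set.Icc 0 t, dist (z + s • u) x < 2 * (δ' / 3) := by
    intro s hs
    have h₁ : dist (z + s • u) z < δ' / 3 := by
      rw [dist_eq_norm, add_sub_cancel_left, norm_smul, Real.norm_of_nonneg hs.1]
      exact (mul_le_mul_of_nonneg_right hs.2 (norm_nonneg u)).trans_lt htu
    linarith [dist_triangle (z + s • u) z x]
  have hzt_ball : z + t • u ∈ Metric.ball x δ' := by
    rw [Metric.mem_ball]
    linarith [hball t ⟨ht.le, le_rfl⟩]
  have hslope : t * α < r' (z + t • u) - r' z := by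
    rw [← heq (hsub hzt_ball), ← heq (hsub hz_ball)]
    have h₁ := (abs_le.1 (hbd z hz_ball _ hzt_ball)).2
    rw [add_sub_cancel_left, norm_smul, Real.norm_of_nonneg ht.le, inner_smul_right] at h₁
    rw [inner_sub_left] at hηα
    have h₂ : t * α < t * (inner ℝ (gradient f z) u - η - inner ℝ a u - η) := by
      gcongr
      linarith
    have h₃ : ε * (t * ‖u‖) ≤ t * η := by
      rw [mul_left_comm]
      gcongr
    linarith
  obtain ⟨s, hs, w, hws, hwd, hwu⟩ := exists_differentiableAt_lt_fderiv hr' ht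
    (show 0 < δ' / 3 by positivity) hslope
  have hwx : dist w x < δ' := by
    linarith [dist_triangle w (z + s • u) x, hball s hs]
  have hev : r =ᶠ[𝓝 w] r' := by
    filter_upwards [Metric.isOpen_ball.mem_nhds (Metric.mem_ball.2 hwx)] with y hy
    exact heq (hsub hy)
  refine ⟨w, hwx.trans_le hδδ', hev.differentiableAt_iff.2 hwd, ?_⟩
  rwa [inner_gradient_left, hev.fderiv_eq]

/-- Where `f` is differentiable, `r` need not be, so gradients cannot simply be subtracted. Instead,
if `v - a` were outside the compact hull, a separating direction `u` would give gradients of `r`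
near `x` with too large a slope along `u`; they are bounded, and a limit contradicts the separation.
-/
theorem clarkeSubdifferential_subset [FiniteDimensional ℝ E] {f r : E → ℝ} {x a : E} {C : NNReal}
    {N : Set E} (hN : N ∈ 𝓝 x) (hr : LipschitzOnWith C r N)
    (hfr : HasStrictFDerivAt (fun z => f z - r z) (innerSL ℝ a) x) :
    clarkeSubdifferential f x ⊆ {a} + clarkeSubdifferential r x := by
  refine convexHull_min (fun v hv => ?_) ((convex_singleton a).add (convex_convexHull ℝ _))
  rw [Set.singleton_add, Set.mem_image]
  refine ⟨v - a, ?_, by abel⟩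
  have hcl : IsClosed (clarkeSubdifferential r x) :=
    (isCompact_convexHull_of_finiteDimensional (isCompact_limitingGradients hN hr)).isClosed
  by_contra hva
  obtain ⟨φ, α, hφ, hφv⟩ := geometric_hahn_banach_closed_point (convex_convexHull ℝ _) hcl hva
  obtain ⟨u, rfl⟩ := (InnerProductSpace.toDual ℝ E).surjective φ
  simp only [InnerProductSpace.toDual_apply_apply] at hφ hφv
  rw [real_inner_comm] at hφv
  choose w hwx hwd hwu using fun k : ℕ => exists_gradient_inner_gt hN hr hfr hv hφv
    (δ := 1 / ((k : ℝ) + 1)) Nat.one_div_pos_of_nat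
  have hwlim : Tendsto w atTop (𝓝 x) := by
    rw [tendsto_iff_dist_tendsto_zero]
    exact squeeze_zero (fun _ => dist_nonneg) (fun k => (hwx k).le)
      tendsto_one_div_add_atTop_nhds_zero_nat
  have hmem : ∀ᶠ k in atTop, gradient r (w k) ∈ Metric.closedBall (0 : E) C := by
    filter_upwards [hwlim.eventually (eventually_mem_nhds_iff.2 hN)] with k hk
    rw [mem_closedBall_zero_iff, norm_gradient]
    exact norm_fderiv_le_of_lipschitzOn ℝ hk hr
  obtain ⟨q, -, ψ, hψ, hq⟩ := (isCompact_closedBall (0 : E) C).tendsto_subseq' hmem.frequently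
  have hqr : q ∈ limitingGradients r x :=
    ⟨w ∘ ψ, fun k => hwd _, hwlim.comp hψ.tendsto_atTop, hq⟩
  have h₁ := hφ q (subset_convexHull ℝ _ hqr)
  have h₂ : α ≤ inner ℝ q u :=
    ge_of_tendsto (hq.inner tendsto_const_nhds) (Eventually.of_forall fun k => (hwu (ψ k)).le)
  rw [real_inner_comm] at h₂
  linarith

/-- The sum rule for the Clarke subdifferential when one summand is strictly differentiable. -/
theorem clarkeSubdifferential_eq_singleton_add [FiniteDimensional ℝ E] {f r : E → ℝ} {x a : E}
    (hr : LocallyLipschitz r) (hfr : HasStrictFDerivAt (fun z => f z - r z) (innerSL ℝ a) x) :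
    clarkeSubdifferential f x = {a} + clarkeSubdifferential r x := by
  obtain ⟨C, N, hN, hrN⟩ := hr x
  refine (clarkeSubdifferential_subset hN hrN hfr).antisymm ?_
  -- The reverse inclusion is the same lemma with `f` and `r` exchanged, `f` being Lipschitz near
  -- `x` as a sum.
  obtain ⟨C', N', hN', hfN'⟩ := hfr.exists_lipschitzOnWith
  have hf : LipschitzOnWith (C' + C) f (N' ∩ N) := by
    have := (hfN'.mono Set.inter_subset_left).add (hrN.mono Set.inter_subset_right)
    simpa using this
  have hrf : HasStrictFDerivAt (fun z => r z - f z) (innerSL ℝ (-a)) x := by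
    have h : (fun z => r z - f z) = -fun z => f z - r z := by
      ext z
      simp
    rw [h, map_neg]
    exact hfr.neg
  rw [Set.singleton_add]
  rintro _ ⟨v, hv, rfl⟩
  obtain ⟨_, rfl, w, hw, rfl⟩ := clarkeSubdifferential_subset (inter_mem hN' hN) hf hrf hv
  simpa using hw

end ClarkeSum

/-! ### Polar, tangent and normal cones -/

section Cones

variable {E : Type*} [NormedAddCommGroup E] [InnerProductSpace ℝ E]

theorem zero_mem_polarCone (K : Set E) : (0 : E) ∈ polarCone K := fun z _ => by simp

theorem isClosed_polarCone (K : Set E) : IsClosed (polarCone K) := by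
  simp only [polarCone, Set.ofPred_forall]
  exact isClosed_biInter fun z _ => isClosed_le (by fun_prop) continuous_const

theorem smul_mem_polarCone {K : Set E} {v : E} (hv : v ∈ polarCone K) {t : ℝ} (ht : 0 ≤ t) :
    t • v ∈ polarCone K := fun z hz => by
  rw [real_inner_smul_left]
  exact mul_nonpos_of_nonneg_of_nonpos ht (hv z hz)

theorem convex_polarCone (K : Set E) : Convex ℝ (polarCone K) := by
  intro v hv w hw a b ha hb _ z hz
  rw [inner_add_left, real_inner_smul_left, real_inner_smul_left]
  exact add_nonpos (mul_nonpos_of_nonneg_of_nonpos ha (hv z hz))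
    (mul_nonpos_of_nonneg_of_nonpos hb (hw z hz))

theorem mem_polarCone_of_inner_le {K : Set E} (hK : ∀ z ∈ K, ∀ t : ℝ, 0 ≤ t → t • z ∈ K)
    {v : E} {M : ℝ} (h : ∀ z ∈ K, inner ℝ v z ≤ M) : v ∈ polarCone K := by
  intro z hz
  by_contra! hpos
  have h₁ := h _ (hK z hz ((|M| + 1) / inner ℝ v z) (by positivity))
  rw [real_inner_smul_right, div_mul_cancel₀ _ hpos.ne'] at h₁
  linarith [le_abs_self M]

/-- The nontrivial half of the bipolar theorem: a functional separating `z` from `K` is bounded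
above on a cone, hence polar, yet positive at `z`. -/
theorem mem_of_forall_polarCone [CompleteSpace E] {K : Set E} (hK : IsClosed K)
    (hKconv : Convex ℝ K) (hKcone : ∀ z ∈ K, ∀ t : ℝ, 0 ≤ t → t • z ∈ K) (h0 : (0 : E) ∈ K)
    {z : E} (hz : ∀ v ∈ polarCone K, inner ℝ v z ≤ 0) : z ∈ K := by
  by_contra hzK
  obtain ⟨φ, u, hφ, hφz⟩ := geometric_hahn_banach_closed_point hKconv hK hzK
  obtain ⟨v, rfl⟩ := (InnerProductSpace.toDual ℝ E).surjective φ
  simp only [InnerProductSpace.toDual_apply_apply] at hφ hφz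
  have h₁ := hz v (mem_polarCone_of_inner_le hKcone fun k hk => (hφ k hk).le)
  have h₂ := hφ 0 h0
  rw [inner_zero_right] at h₂
  linarith

/-- A cone-convex map satisfies Jensen's inequality in the order of the cone. -/
theorem sub_combo_mem_of_convexOn {F : Type*} [AddCommGroup F] [Module ℝ F] [CompleteSpace E]
    {K : Set E} (hK : IsClosed K) (hKconv : Convex ℝ K)
    (hKcone : ∀ z ∈ K, ∀ t : ℝ, 0 ≤ t → t • z ∈ K) (h0 : (0 : E) ∈ K) {D : Set F} {c : F → E}
    (hc : ∀ l ∈ polarCone K, ConvexOn ℝ D fun y => inner ℝ l (c y)) {y₁ y₂ : F} (h₁ : y₁ ∈ D)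
    (h₂ : y₂ ∈ D) {a b : ℝ} (ha : 0 ≤ a) (hb : 0 ≤ b) (hab : a + b = 1) :
    c (a • y₁ + b • y₂) - (a • c y₁ + b • c y₂) ∈ K := by
  refine mem_of_forall_polarCone hK hKconv hKcone h0 fun l hl => ?_
  have := (hc l hl).2 h₁ h₂ ha hb hab
  simp only [smul_eq_mul] at this
  rw [inner_sub_right, inner_add_right, real_inner_smul_right, real_inner_smul_right]
  linarith

theorem add_mem_of_cone {K : Set E} (hKconv : Convex ℝ K)
    (hKcone : ∀ z ∈ K, ∀ t : ℝ, 0 ≤ t → t • z ∈ K) {v w : E} (hv : v ∈ K) (hw : w ∈ K) :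
    v + w ∈ K := by
  have := hKconv (hKcone v hv 2 (by norm_num)) (hKcone w hw 2 (by norm_num))
    (show (0 : ℝ) ≤ 1 / 2 by norm_num) (show (0 : ℝ) ≤ 1 / 2 by norm_num) (by norm_num)
  simpa [smul_smul] using this

theorem sub_mem_clarkeTangentCone {S : Set E} (hS : Convex ℝ S) {x z : E} (hz : z ∈ S) :
    z - x ∈ clarkeTangentCone S x := by
  intro w t hw hwx ht ht0
  classical
  -- The step `t k` along `z - w k` stays on the segment towards `z` only if `t k ≤ 1`; the default
  -- `0` matters for finitely many `k`.
  refine ⟨fun k => if t k ≤ 1 then z - w k else 0, ?_, fun k => ?_⟩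
  · refine (tendsto_const_nhds.sub hwx).congr' ?_
    filter_upwards [ht0.eventually_le_const one_pos] with k hk
    simp [hk]
  · by_cases hk : t k ≤ 1
    · simp only [hk, if_true]
      exact hS.add_smul_sub_mem (hw k) hz ⟨(ht k).le, hk⟩
    · simpa [hk] using hw k

theorem clarkeTangentCone_subset_posTangentConeAt {S : Set E} {x : E} (hx : x ∈ S) :
    clarkeTangentCone S x ⊆ posTangentConeAt S x := by
  intro d hd
  have ht : ∀ k : ℕ, 0 < 1 / ((k : ℝ) + 1) := fun k => Nat.one_div_pos_of_nat
  obtain ⟨e, he, heS⟩ := hd (fun _ => x) (fun k => 1 / ((k : ℝ) + 1)) (fun _ => hx)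
    tendsto_const_nhds ht tendsto_one_div_add_atTop_nhds_zero_nat
  refine mem_tangentConeAt_of_seq atTop (fun k : ℕ => (k : NNReal) + 1)
    (fun k : ℕ => (1 / ((k : ℝ) + 1)) • e k) ?_ (Eventually.of_forall heS) ?_
  · simpa using (tendsto_one_div_add_atTop_nhds_zero_nat (𝕜 := ℝ)).smul he
  · refine he.congr fun k => ?_
    rw [NNReal.smul_def, smul_smul]
    have : ((k : ℝ) + 1) ≠ 0 := by positivity
    simp [this]

/-- The first order necessary condition at a local maximum. -/
theorem fderiv_nonpos_of_isLocalMaxOn {S : Set E} {x : E} (hx : x ∈ S) {f : E → ℝ}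
    {f' : E →L[ℝ] ℝ} (hf : HasFDerivAt f f' x) (hmax : IsLocalMaxOn f S x) {d : E}
    (hd : d ∈ clarkeTangentCone S x) : f' d ≤ 0 :=
  hmax.hasFDerivWithinAt_nonpos hf.hasFDerivWithinAt
    (clarkeTangentCone_subset_posTangentConeAt hx hd)

theorem mem_clarkeNormalCone_of_forall_sub {S : Set E} {x v : E} (hx : x ∈ S)
    (h : ∀ z ∈ S, inner ℝ v (z - x) ≤ 0) : v ∈ clarkeNormalCone S x := fun d hd =>
  fderiv_nonpos_of_isLocalMaxOn hx (innerSL ℝ v).hasFDerivAt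
    (IsMaxOn.localize fun z hz => by simpa [inner_sub_right] using h z hz) hd

theorem inner_sub_nonpos_of_mem_clarkeNormalCone {S : Set E} (hS : Convex ℝ S) {x v z : E}
    (hv : v ∈ clarkeNormalCone S x) (hz : z ∈ S) : inner ℝ v (z - x) ≤ 0 :=
  hv _ (sub_mem_clarkeTangentCone hS hz)

/-- Complementarity: normal vectors of a polar cone. -/
theorem mem_clarkeNormalCone_polarCone_iff [CompleteSpace E] {K : Set E} (hK : IsClosed K)
    (hKconv : Convex ℝ K) (hKcone : ∀ z ∈ K, ∀ t : ℝ, 0 ≤ t → t • z ∈ K) (h0 : (0 : E) ∈ K)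
    {l z : E} (hl : l ∈ polarCone K) :
    z ∈ clarkeNormalCone (polarCone K) l ↔ z ∈ K ∧ inner ℝ l z = 0 := by
  constructor
  · intro h
    have h₁ : ∀ l' ∈ polarCone K, inner ℝ l' z ≤ inner ℝ l z := fun l' hl' => by
      have := inner_sub_nonpos_of_mem_clarkeNormalCone (convex_polarCone K) h hl'
      rw [inner_sub_right, real_inner_comm, real_inner_comm l z] at this
      linarith
    -- Testing with `0` and `2 • l` gives the two inequalities behind `⟪l, z⟫ = 0`.
    have h₂ := h₁ 0 (zero_mem_polarCone K)
    have h₃ := h₁ _ (smul_mem_polarCone hl zero_le_two)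
    rw [inner_zero_left] at h₂
    rw [real_inner_smul_left] at h₃
    have h₄ : inner ℝ l z = 0 := by linarith
    exact ⟨mem_of_forall_polarCone hK hKconv hKcone h0 fun v hv => (h₁ v hv).trans h₄.le, h₄⟩
  · rintro ⟨hz, hlz⟩
    refine mem_clarkeNormalCone_of_forall_sub hl fun v hv => ?_
    rw [inner_sub_right, real_inner_comm, real_inner_comm l z, hlz, sub_zero]
    exact hv z hz

/-- The supergradient inequality for concave functions. -/
theorem sub_le_fderiv_of_concaveOn {S : Set E} {f : E → ℝ} (hf : ConcaveOn ℝ S f) {x z : E}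
    {f' : E →L[ℝ] ℝ} (hx : x ∈ S) (hz : z ∈ S) (hf' : HasFDerivAt f f' x) :
    f z - f x ≤ f' (z - x) := by
  have hd : HasDerivAt (fun t : ℝ => f (x + t • (z - x))) (f' (z - x)) 0 := by
    have h1 : HasDerivAt (fun s : ℝ => x + s • (z - x)) (z - x) 0 := by
      simpa using ((hasDerivAt_id (0 : ℝ)).smul_const (z - x)).const_add x
    refine HasFDerivAt.comp_hasDerivAt (x := (0 : ℝ)) (f := fun s : ℝ => x + s • (z - x)) ?_ h1
    simpa using hf'
  have h₁ := (hasDerivAt_iff_tendsto_slope_zero.1 hd).mono_left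
    (nhdsWithin_mono (0 : ℝ) (s := Set.Ioi 0) fun t (ht : 0 < t) => ht.ne')
  refine ge_of_tendsto h₁ ?_
  filter_upwards [Ioc_mem_nhdsGT (zero_lt_one' ℝ)] with t ht
  have h₂ := hf.2 hx hz (sub_nonneg.2 ht.2) ht.1.le (by ring)
  have h₃ : (1 - t) • x + t • z = x + t • (z - x) := by
    rw [sub_smul, smul_sub, one_smul]
    abel
  rw [h₃, smul_eq_mul, smul_eq_mul] at h₂
  simp only [zero_add, zero_smul, add_zero, smul_eq_mul]
  rw [inv_mul_eq_div, le_div_iff₀ ht.1]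
  linarith

end Cones

/-! ### Convex duality through the perturbation function -/

section Hypograph

variable {F H : Type*} [NormedAddCommGroup F] [NormedAddCommGroup H]

/-- The hypograph of the perturbation function of the problem of maximizing `g` over `D` subject
to `c y ∈ K`. -/
def perturbationHypograph (D : Set F) (K : Set H) (g : F → ℝ) (c : F → H) : Set (H × ℝ) :=
  {q | ∃ y ∈ D, c y - q.1 ∈ K ∧ q.2 ≤ g y}

/-- A closed set plus a compact one is closed. This permits strict separation of points without `K`
having interior. -/
theorem isClosed_perturbationHypograph {D : Set F} {K : Set H} (hK : IsClosed K)
    (hD : IsCompact D) {g : F → ℝ} {c : F → H} (hg : ContinuousOn g D) (hc : ContinuousOn c D) :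
    IsClosed (perturbationHypograph D K g c) := by
  have h : perturbationHypograph D K g c =
      (-K) ×ˢ Set.Iic (0 : ℝ) + (fun y => (c y, g y)) '' D := by
    ext ⟨v, r⟩
    simp only [perturbationHypograph, Set.mem_ofPred_eq, Set.mem_add, Set.mem_prod, Set.mem_neg,
      Set.mem_Iic, Set.mem_image, Prod.exists]
    constructor
    · rintro ⟨y, hy, hv, hr⟩
      exact ⟨v - c y, r - g y, ⟨by simpa using hv, by simpa using hr⟩, c y, g y,
        ⟨y, hy, rfl⟩, by simp⟩
    · rintro ⟨w, s, ⟨hw, hs⟩, _, _, ⟨y, hy, ⟨rfl, rfl⟩⟩, h⟩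
      obtain ⟨rfl, rfl⟩ := Prod.mk.inj h
      exact ⟨y, hy, by simpa using hw, by simpa using hs⟩
  rw [h]
  exact (hK.neg.prod isClosed_Iic).add_right_of_isCompact (hD.image_of_continuousOn (hc.prodMk hg))

end Hypograph

section Duality

variable {F H : Type*} [NormedAddCommGroup F] [InnerProductSpace ℝ F]
  [NormedAddCommGroup H] [InnerProductSpace ℝ H]

theorem convex_perturbationHypograph [CompleteSpace H] {D : Set F} {K : Set H} (hK : IsClosed K)
    (hKconv : Convex ℝ K) (hKcone : ∀ z ∈ K, ∀ t : ℝ, 0 ≤ t → t • z ∈ K) (h0 : (0 : H) ∈ K)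
    {g : F → ℝ} {c : F → H} (hg : ConcaveOn ℝ D g)
    (hc : ∀ l ∈ polarCone K, ConvexOn ℝ D fun y => inner ℝ l (c y)) :
    Convex ℝ (perturbationHypograph D K g c) := by
  rintro ⟨v₁, r₁⟩ ⟨y₁, hy₁, hv₁, hr₁⟩ ⟨v₂, r₂⟩ ⟨y₂, hy₂, hv₂, hr₂⟩ a b ha hb hab
  refine ⟨a • y₁ + b • y₂, hg.1 hy₁ hy₂ ha hb hab, ?_, ?_⟩
  · have h₁ := sub_combo_mem_of_convexOn hK hKconv hKcone h0 hc hy₁ hy₂ ha hb hab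
    have h₂ := add_mem_of_cone hKconv hKcone h₁ (add_mem_of_cone hKconv hKcone
      (hKcone _ hv₁ a ha) (hKcone _ hv₂ b hb))
    convert h₂ using 1
    simp only [Prod.fst_add, Prod.smul_fst, smul_sub]
    abel
  · refine le_trans ?_ (hg.2 hy₁ hy₂ ha hb hab)
    simp only [Prod.snd_add, Prod.smul_snd]
    gcongr

/-- Separation of a point from the hypograph of the perturbation function. -/
theorem exists_separation_perturbationHypograph [CompleteSpace H] {D : Set F} {K : Set H}
    (hK : IsClosed K) (hKconv : Convex ℝ K)
    (hKcone : ∀ z ∈ K, ∀ t : ℝ, 0 ≤ t → t • z ∈ K) (h0 : (0 : H) ∈ K) (hD : IsCompact D)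
    {g : F → ℝ} {c : F → H} (hg : ConcaveOn ℝ D g) (hgc : ContinuousOn g D)
    (hc : ∀ l ∈ polarCone K, ConvexOn ℝ D fun y => inner ℝ l (c y)) (hcc : ContinuousOn c D)
    (hne : D.Nonempty) {M : ℝ} (hM : ((0 : H), M) ∉ perturbationHypograph D K g c) :
    ∃ l ∈ polarCone K, ∃ α : ℝ, 0 ≤ α ∧ ∀ y ∈ D, α * g y - inner ℝ l (c y) < α * M := by
  obtain ⟨φ, u, hφ, hφM⟩ := geometric_hahn_banach_closed_point
    (convex_perturbationHypograph hK hKconv hKcone h0 hg hc)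
    (isClosed_perturbationHypograph hK hD hgc hcc) hM
  obtain ⟨v, hv⟩ := (InnerProductSpace.toDual ℝ H).surjective
    (φ.comp (ContinuousLinearMap.inl ℝ H ℝ))
  have hφ_eq : ∀ w r, φ (w, r) = inner ℝ v w + φ (0, 1) * r := by
    intro w r
    have h₁ : inner ℝ v w = φ (w, 0) := by
      rw [← InnerProductSpace.toDual_apply_apply (𝕜 := ℝ), hv]
      simp
    have h₂ : ((w, r) : H × ℝ) = (w, 0) + r • (0, 1) := by simp
    rw [h₁, h₂, map_add, map_smul, smul_eq_mul, mul_comm]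
  set α := φ (0, 1) with hα_def
  -- The hypograph recedes along `-k` and `-s`; boundedness of the functional in these directions
  -- forces `-v ∈ polarCone K` and `0 ≤ α`.
  have hmem : ∀ y ∈ D, ∀ k ∈ K, ∀ s : ℝ, 0 ≤ s →
      inner ℝ v (c y - k) + α * (g y - s) < α * M := by
    intro y hy k hk s hs
    have h₁ := hφ (c y - k, g y - s) ⟨y, hy, by simpa using hk, by simpa using hs⟩
    rw [hφ_eq] at h₁ hφM
    rw [inner_zero_right] at hφM
    linarith
  obtain ⟨y₀, hy₀⟩ := hne
  refine ⟨-v, ?_, α, ?_, fun y hy => ?_⟩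
  · refine mem_polarCone_of_inner_le hKcone (M := α * M - inner ℝ v (c y₀) - α * g y₀)
      fun k hk => ?_
    have := hmem y₀ hy₀ k hk 0 le_rfl
    rw [inner_sub_right] at this
    rw [inner_neg_left]
    linarith
  · by_contra! hα
    set B := α * M - inner ℝ v (c y₀) - α * g y₀
    have := hmem y₀ hy₀ 0 h0 (|B| / -α) (div_nonneg (abs_nonneg _) (by linarith))
    rw [sub_zero, mul_sub] at this
    have h₂ : α * (|B| / -α) = -|B| := by
      rw [div_neg, mul_neg, mul_div_cancel₀ _ hα.ne]
    rw [h₂] at this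
    linarith [le_abs_self B]
  · have := hmem y hy 0 h0 0 le_rfl
    rw [sub_zero, sub_zero] at this
    rw [inner_neg_left]
    linarith

/-- Existence of a solution and of a Lagrange multiplier for a convex problem on a compact convex
set under a quantitative Slater condition. -/
theorem exists_isMaxOn_and_multiplier [FiniteDimensional ℝ H] {D : Set F} {K : Set H}
    (hK : IsClosed K) (hKconv : Convex ℝ K)
    (hKcone : ∀ z ∈ K, ∀ t : ℝ, 0 ≤ t → t • z ∈ K) (h0 : (0 : H) ∈ K) (hD : IsCompact D)
    {g : F → ℝ} {c : F → H} (hg : ConcaveOn ℝ D g) (hgc : ContinuousOn g D)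
    (hc : ∀ l ∈ polarCone K, ConvexOn ℝ D fun y => inner ℝ l (c y)) (hcc : ContinuousOn c D)
    {δ : ℝ} (hδ : 0 < δ) (hS : ∀ l ∈ polarCone K, ∃ y ∈ D, inner ℝ l (c y) ≤ -(δ * ‖l‖)) :
    ∃ y ∈ D, c y ∈ K ∧ (∀ y' ∈ D, c y' ∈ K → g y' ≤ g y) ∧
      ∃ l ∈ polarCone K, ∀ y' ∈ D, g y' - inner ℝ l (c y') ≤ g y := by
  have hne : D.Nonempty := by
    obtain ⟨y, hy, -⟩ := hS 0 (zero_mem_polarCone K)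
    exact ⟨y, hy⟩
  obtain ⟨ym, hym, hmin⟩ := hD.exists_isMinOn hne hgc
  -- Were the problem infeasible, even the minimal level `g ym` could be separated, which the Slater
  -- inequality contradicts.
  have hfeas : (D ∩ c ⁻¹' K).Nonempty := by
    by_contra hemp
    have hnot : ((0 : H), g ym) ∉ perturbationHypograph D K g c := by
      rintro ⟨y, hy, hcy, -⟩
      exact hemp ⟨y, hy, by simpa using hcy⟩
    obtain ⟨l, hl, α, hα, hlt⟩ := exists_separation_perturbationHypograph hK hKconv hKcone h0 hD
      hg hgc hc hcc hne hnot
    obtain ⟨y, hy, hyl⟩ := hS l hl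
    have h₁ := hlt y hy
    have h₂ : α * g ym ≤ α * g y := mul_le_mul_of_nonneg_left (hmin hy) hα
    nlinarith [norm_nonneg l]
  obtain ⟨y, ⟨hyD, hyK⟩, hmax⟩ :=
    (hD.of_isClosed_subset (hcc.preimage_isClosed_of_isClosed hD.isClosed hK)
      Set.inter_subset_left).exists_isMaxOn hfeas (hgc.mono Set.inter_subset_left)
  refine ⟨y, hyD, hyK, fun y' h₁ h₂ => hmax ⟨h₁, h₂⟩, ?_⟩
  -- The point `(0, g y)` lies in the hypograph, so separation is strict only above it. The
  -- resulting approximate multipliers are bounded by Slater and subconverge.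
  have happrox : ∀ k : ℕ, ∃ l ∈ polarCone K,
      ∀ y' ∈ D, g y' - inner ℝ l (c y') ≤ g y + 1 / ((k : ℝ) + 1) := by
    intro k
    have hε : 0 < 1 / ((k : ℝ) + 1) := Nat.one_div_pos_of_nat
    have hnot : ((0 : H), g y + 1 / ((k : ℝ) + 1)) ∉ perturbationHypograph D K g c := by
      rintro ⟨y', hy', hcy', hgy'⟩
      have h₁ : g y' ≤ g y := hmax ⟨hy', by simpa using hcy'⟩
      simp only at hgy'
      linarith
    obtain ⟨l, hl, α, hα, hlt⟩ := exists_separation_perturbationHypograph hK hKconv hKcone h0 hD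
      hg hgc hc hcc hne hnot
    -- With `α = 0`, the inequality at the feasible `y` would make `⟪l, c y⟫` positive.
    have hα : 0 < α := by
      refine hα.lt_of_ne fun h => ?_
      have h₁ := hlt y hyD
      rw [← h] at h₁
      linarith [hl _ hyK]
    refine ⟨α⁻¹ • l, smul_mem_polarCone hl (by positivity), fun y' hy' => ?_⟩
    have h₁ := (hlt y' hy').le
    rw [real_inner_smul_left, ← mul_le_mul_iff_right₀ hα, mul_sub, mul_inv_cancel_left₀ hα.ne']
    exact h₁
  choose l hl hle using happrox
  have hbd : ∀ k, l k ∈ Metric.closedBall (0 : H) ((g y + 1 - g ym) / δ) := by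
    intro k
    rw [mem_closedBall_zero_iff, le_div_iff₀ hδ]
    obtain ⟨y', hy', hyl⟩ := hS _ (hl k)
    have h₁ := hle k y' hy'
    have h₂ : g ym ≤ g y' := hmin hy'
    have h₃ : 1 / ((k : ℝ) + 1) ≤ 1 := by
      rw [div_le_one (by positivity)]
      linarith [k.cast_nonneg (α := ℝ)]
    linarith
  obtain ⟨l₀, -, ψ, hψ, hlim⟩ := (isCompact_closedBall (0 : H) _).tendsto_subseq hbd
  refine ⟨l₀, (isClosed_polarCone K).mem_of_tendsto hlim (Eventually.of_forall fun k => hl _),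
    fun y' hy' => ?_⟩
  have h₁ : Tendsto (fun k => g y + 1 / ((ψ k : ℝ) + 1)) atTop (𝓝 (g y + 0)) :=
    tendsto_const_nhds.add (tendsto_one_div_add_atTop_nhds_zero_nat.comp hψ.tendsto_atTop)
  rw [add_zero] at h₁
  exact le_of_tendsto_of_tendsto (tendsto_const_nhds.sub (hlim.inner tendsto_const_nhds)) h₁
    (Eventually.of_forall fun k => hle (ψ k) y' hy')

end Duality

/-! ### Uniform Slater condition -/

section Slater

variable {F H : Type*} [NormedAddCommGroup H] [InnerProductSpace ℝ H]

/-- The Slater condition in dual form is stable under perturbation, with a uniform constant. -/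
theorem eventually_uniform_slater {E : Type*} [TopologicalSpace E] [FiniteDimensional ℝ H]
    {D : Set F} {K : Set H} {c : E → F → H} {x : E} (hne : D.Nonempty)
    (hc : ∀ y ∈ D, ContinuousAt (fun x' => c x' y) x)
    (hS : ∀ l ∈ polarCone K, l ≠ 0 → ∃ y ∈ D, inner ℝ l (c x y) < 0) :
    ∃ δ > 0, ∀ᶠ x' in 𝓝 x, ∀ l ∈ polarCone K, ∃ y ∈ D, inner ℝ l (c x' y) ≤ -(δ * ‖l‖) := by
  have hcomp : IsCompact (Metric.sphere (0 : H) 1 ∩ polarCone K) :=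
    (isCompact_sphere 0 1).inter_right (isClosed_polarCone K)
  -- By homogeneity unit vectors suffice. One `y` serves a neighbourhood of each `(x, l)`, and
  -- compactness of the unit polar vectors leaves finitely many constants.
  have key : ∃ δ > 0, ∀ᶠ x' in 𝓝 x, ∀ l ∈ Metric.sphere (0 : H) 1 ∩ polarCone K,
      ∃ y ∈ D, inner ℝ l (c x' y) ≤ -δ := by
    refine hcomp.induction_on (p := fun s => ∃ δ > 0, ∀ᶠ x' in 𝓝 x, ∀ l ∈ s,
      ∃ y ∈ D, inner ℝ l (c x' y) ≤ -δ) ⟨1, one_pos, by simp⟩ ?_ ?_ ?_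
    · rintro s t hst ⟨δ, hδ, h⟩
      exact ⟨δ, hδ, h.mono fun x' hx' l hl => hx' l (hst hl)⟩
    · rintro s t ⟨δ₁, hδ₁, h₁⟩ ⟨δ₂, hδ₂, h₂⟩
      refine ⟨min δ₁ δ₂, lt_min hδ₁ hδ₂, ?_⟩
      filter_upwards [h₁, h₂] with x' hx₁ hx₂ l hl
      rcases hl with hl | hl
      · obtain ⟨y, hy, hle⟩ := hx₁ l hl
        exact ⟨y, hy, hle.trans (neg_le_neg (min_le_left _ _))⟩
      · obtain ⟨y, hy, hle⟩ := hx₂ l hl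
        exact ⟨y, hy, hle.trans (neg_le_neg (min_le_right _ _))⟩
    · rintro l ⟨hl1, hl⟩
      have hl0 : l ≠ 0 := by
        rintro rfl
        simp at hl1
      obtain ⟨y, hy, hlt⟩ := hS l hl hl0
      have hcont : ContinuousAt (fun q : E × H => inner ℝ q.2 (c q.1 y)) (x, l) :=
        continuousAt_snd.inner ((hc y hy).comp_of_eq continuousAt_fst rfl)
      have h₁ : ∀ᶠ q : E × H in 𝓝 x ×ˢ 𝓝 l,
          inner ℝ q.2 (c q.1 y) ≤ inner ℝ l (c x y) / 2 := by
        rw [← nhds_prod_eq]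
        exact hcont.eventually_le_const (by linarith)
      obtain ⟨pa, hpa, pb, hpb, hab⟩ := eventually_prod_iff.1 h₁
      refine ⟨{l | pb l}, nhdsWithin_le_nhds hpb, -inner ℝ l (c x y) / 2, by linarith,
        hpa.mono fun x' hx' l' hl' => ⟨y, hy, ?_⟩⟩
      have := hab hx' hl'
      simp only at this
      linarith
  obtain ⟨δ, hδ, h⟩ := key
  refine ⟨δ, hδ, h.mono fun x' hx' l hl => ?_⟩
  rcases eq_or_ne l 0 with rfl | hl0
  · obtain ⟨y, hy⟩ := hne
    exact ⟨y, hy, by simp⟩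
  · have hn : 0 < ‖l‖ := norm_pos_iff.2 hl0
    obtain ⟨y, hy, hle⟩ := hx' (‖l‖⁻¹ • l)
      ⟨by simp [norm_smul, hn.ne'], smul_mem_polarCone hl (by positivity)⟩
    refine ⟨y, hy, ?_⟩
    rw [real_inner_smul_left, inv_mul_eq_div, div_le_iff₀ hn] at hle
    linarith

end Slater

/-! ### Envelope theorem -/

section Envelope

variable {E F H : Type*} [NormedAddCommGroup E] [NormedAddCommGroup F]
  [InnerProductSpace ℝ F] [NormedAddCommGroup H] [InnerProductSpace ℝ H]

/-- An envelope theorem: the value of a family of convex problems is strictly differentiable where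
solutions and multipliers converge. -/
theorem hasStrictFDerivAt_envelope [NormedSpace ℝ E] {D : Set F} {K : Set H} {g : E → F → ℝ}
    {c : E → F → H} {h : E → ℝ} {yf : E → F} {lf : E → H} {x : E} {y : F} {l : H}
    {G : E × F →L[ℝ] ℝ} {C : E × F →L[ℝ] H}
    (hg : HasStrictFDerivAt (Function.uncurry g) G (x, y))
    (hc : HasStrictFDerivAt (Function.uncurry c) C (x, y))
    (hy : Tendsto yf (𝓝 x) (𝓝 y)) (hl : Tendsto lf (𝓝 x) (𝓝 l))
    (hev : ∀ᶠ x' in 𝓝 x, h x' = g x' (yf x') ∧ yf x' ∈ D ∧ c x' (yf x') ∈ K ∧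
      lf x' ∈ polarCone K ∧ ∀ y' ∈ D, g x' y' - inner ℝ (lf x') (c x' y') ≤ h x') :
    HasStrictFDerivAt h (G.comp (ContinuousLinearMap.inl ℝ E F) -
      (innerSL ℝ l).comp (C.comp (ContinuousLinearMap.inl ℝ E F))) x := by
  set A := G.comp (ContinuousLinearMap.inl ℝ E F) -
      (innerSL ℝ l).comp (C.comp (ContinuousLinearMap.inl ℝ E F)) with hA
  -- Use the solution at `p.1` with the multiplier at `p.2`: weak duality bounds `h p.1 - h p.2` by
  -- the increment of the Lagrangian, and `ρ` is its linearisation error. Only convergence of `yf`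
  -- and `lf` is needed, no rate.
  let ρ : E × E → ℝ := fun p =>
    (g p.1 (yf p.1) - g p.2 (yf p.1) - G (p.1 - p.2, 0)) -
      inner ℝ (lf p.2) (c p.1 (yf p.1) - c p.2 (yf p.1) - C (p.1 - p.2, 0)) -
      inner ℝ (lf p.2 - l) (C (p.1 - p.2, 0))
  have hfst : Tendsto Prod.fst (𝓝 (x, x)) (𝓝 x) := continuous_fst.tendsto' _ _ rfl
  have hsnd : Tendsto Prod.snd (𝓝 (x, x)) (𝓝 x) := continuous_snd.tendsto' _ _ rfl
  have hpair : Tendsto (fun p : E × E => ((p.1, yf p.1), (p.2, yf p.1))) (𝓝 (x, x))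
      (𝓝 ((x, y), (x, y))) :=
    (hfst.prodMk_nhds (hy.comp hfst)).prodMk_nhds (hsnd.prodMk_nhds (hy.comp hfst))
  have hdiff : (fun p : E × E => ((p.1 - p.2, 0) : E × F)) =O[𝓝 (x, x)] fun p => p.1 - p.2 :=
    Asymptotics.IsBigO.of_bound 1 (Eventually.of_forall fun p => by simp [Prod.norm_def])
  have hgo : (fun p : E × E => g p.1 (yf p.1) - g p.2 (yf p.1) - G (p.1 - p.2, 0))
      =o[𝓝 (x, x)] fun p => p.1 - p.2 := by
    refine Asymptotics.IsLittleO.trans_isBigO ?_ hdiff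
    simpa [Function.comp_def, -map_sub] using hg.isLittleO.comp_tendsto hpair
  have hco : (fun p : E × E => c p.1 (yf p.1) - c p.2 (yf p.1) - C (p.1 - p.2, 0))
      =o[𝓝 (x, x)] fun p => p.1 - p.2 := by
    refine Asymptotics.IsLittleO.trans_isBigO ?_ hdiff
    simpa [Function.comp_def, -map_sub] using hc.isLittleO.comp_tendsto hpair
  have hCO : (fun p : E × E => C (p.1 - p.2, 0)) =O[𝓝 (x, x)] fun p => p.1 - p.2 :=
    (C.isBigO_comp _ _).trans hdiff
  have hlO : (fun p : E × E => lf p.2) =O[𝓝 (x, x)] fun _ => (1 : ℝ) :=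
    (hl.comp hsnd).isBigO_one ℝ
  have hlo : (fun p : E × E => lf p.2 - l) =o[𝓝 (x, x)] fun _ => (1 : ℝ) :=
    (Asymptotics.isLittleO_one_iff ℝ).2 (by simpa using (hl.comp hsnd).sub_const l)
  have inner_le : ∀ u v : E × E → H, (fun p => inner ℝ (u p) (v p)) =O[𝓝 (x, x)]
      fun p => ‖u p‖ * ‖v p‖ := fun u v =>
    Asymptotics.IsBigO.of_bound 1 (Eventually.of_forall fun p => by
      simpa using abs_real_inner_le_norm (u p) (v p))
  have hρ : ρ =o[𝓝 (x, x)] fun p => p.1 - p.2 := by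
    refine (hgo.sub ?_).sub ?_
    · refine (inner_le _ _).trans_isLittleO ?_
      rw [← Asymptotics.isLittleO_norm_right]
      simpa using hlO.norm_left.mul_isLittleO (hco.norm_left.norm_right)
    · refine (inner_le _ _).trans_isLittleO ?_
      rw [← Asymptotics.isLittleO_norm_right]
      simpa using hlo.norm_left.mul_isBigO (hCO.norm_left.norm_right)
  -- Exchanging the two parameters turns the upper bound into the lower one.
  have hswap : Tendsto (Prod.swap : E × E → E × E) (𝓝 (x, x)) (𝓝 (x, x)) :=
    continuous_swap.tendsto' _ _ rfl
  have hρ' : (ρ ∘ Prod.swap) =o[𝓝 (x, x)] fun p => p.1 - p.2 := by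
    refine (hρ.comp_tendsto hswap).trans_isBigO
      (Asymptotics.IsBigO.of_bound 1 (Eventually.of_forall fun p => ?_))
    simp [norm_sub_rev]
  have hle : ∀ᶠ p : E × E in 𝓝 (x, x), h p.1 - h p.2 - A (p.1 - p.2) ≤ ρ p := by
    filter_upwards [hfst.eventually hev, hsnd.eventually hev] with p h₁ h₂
    obtain ⟨hv₁, hD₁, hK₁, -, -⟩ := h₁
    obtain ⟨-, -, -, hl₂, hm₂⟩ := h₂
    have h₃ := hm₂ _ hD₁
    have h₄ := hl₂ _ hK₁
    simp only [ρ, hA, inner_sub_right, inner_sub_left, sub_apply,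
      ContinuousLinearMap.comp_apply, ContinuousLinearMap.inl_apply, innerSL_apply_apply]
    linarith
  refine .of_isLittleO ((Asymptotics.IsBigO.of_bound 1 ?_).trans_isLittleO
    (hρ.norm_left.add hρ'.norm_left))
  filter_upwards [hle, hswap.eventually hle] with p h₁ h₂
  simp only [Prod.fst_swap, Prod.snd_swap, Function.comp_apply] at h₂ ⊢
  rw [← neg_sub p.1 p.2, map_neg] at h₂
  simp only [Real.norm_eq_abs]
  rw [one_mul, abs_of_nonneg (add_nonneg (abs_nonneg (ρ p)) (abs_nonneg (ρ p.swap))), abs_le]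
  constructor
  · linarith [le_abs_self (ρ p.swap), abs_nonneg (ρ p)]
  · linarith [le_abs_self (ρ p), abs_nonneg (ρ p.swap)]

end Envelope

/-! ### Stability of solutions and multipliers -/

section Stability

variable {E F H : Type*} [NormedAddCommGroup E] [NormedSpace ℝ E] [FiniteDimensional ℝ E]
  [NormedAddCommGroup F] [InnerProductSpace ℝ F] [FiniteDimensional ℝ F]
  [NormedAddCommGroup H] [InnerProductSpace ℝ H] [FiniteDimensional ℝ H]

/-- Stability of the solution and of the multiplier of a convex problem with a unique solution and
at most one multiplier; only local regularity of the data is assumed. -/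
theorem exists_tendsto_solution_multiplier {Y : Set F} (hY : IsClosed Y) {K : Set H}
    (hK : IsClosed K) (hKconv : Convex ℝ K)
    (hKcone : ∀ z ∈ K, ∀ t : ℝ, 0 ≤ t → t • z ∈ K) {g : E → F → ℝ} {c : E → F → H} {x : E} {y : F}
    {r : ℝ} (hr : 0 < r)
    (hgc : ContinuousOn (Function.uncurry g) (Metric.closedBall x r ×ˢ Metric.closedBall y r))
    (hcc : ContinuousOn (Function.uncurry c) (Metric.closedBall x r ×ˢ Metric.closedBall y r))
    (hg : ∀ᶠ x' in 𝓝 x, StrictConcaveOn ℝ Y (g x'))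
    (hc : ∀ᶠ x' in 𝓝 x, ∀ l ∈ polarCone K, ConvexOn ℝ Y fun y => inner ℝ l (c x' y))
    (hyY : y ∈ Y) (hyK : c x y ∈ K) (hmax : ∀ y' ∈ Y, c x y' ∈ K → g x y' ≤ g x y)
    (hS : ∀ l ∈ polarCone K, l ≠ 0 →
      ∃ y' ∈ Y ∩ Metric.closedBall y r, inner ℝ l (c x y') < 0)
    (huniq : ∀ l₁ ∈ polarCone K, ∀ l₂ ∈ polarCone K,
      (∀ y' ∈ Y ∩ Metric.closedBall y r, g x y' - inner ℝ l₁ (c x y') ≤ g x y) →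
      (∀ y' ∈ Y ∩ Metric.closedBall y r, g x y' - inner ℝ l₂ (c x y') ≤ g x y) → l₁ = l₂) :
    ∃ l ∈ polarCone K,
      (∀ y' ∈ Y ∩ Metric.closedBall y r, g x y' - inner ℝ l (c x y') ≤ g x y) ∧
      ∃ (yf : E → F) (lf : E → H), Tendsto yf (𝓝 x) (𝓝 y) ∧ Tendsto lf (𝓝 x) (𝓝 l) ∧
        ∀ᶠ x' in 𝓝 x, yf x' ∈ Y ∩ Metric.closedBall y r ∧ c x' (yf x') ∈ K ∧
          lf x' ∈ polarCone K ∧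
          (∀ y' ∈ Y ∩ Metric.closedBall y r,
            g x' y' - inner ℝ (lf x') (c x' y') ≤ g x' (yf x')) ∧
          ∀ y' ∈ Y, c x' y' ∈ K → g x' y' ≤ g x' (yf x') := by
  set D := Y ∩ Metric.closedBall y r with hD_def
  set N := Metric.closedBall x r
  have hN : N ∈ 𝓝 x := Metric.closedBall_mem_nhds x hr
  have hxN : x ∈ N := mem_of_mem_nhds hN
  have h0 : (0 : H) ∈ K := by simpa using hKcone _ hyK 0 le_rfl
  have hYconv : Convex ℝ Y := hg.self_of_nhds.1
  have hD : IsCompact D := (isCompact_closedBall y r).inter_left hY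
  have hDconv : Convex ℝ D := hYconv.inter (convex_closedBall y r)
  have hyD : y ∈ D := ⟨hyY, Metric.mem_closedBall_self hr.le⟩
  have hsub : N ×ˢ D ⊆ N ×ˢ Metric.closedBall y r := Set.prod_mono le_rfl Set.inter_subset_right
  have hgc' := hgc.mono hsub
  have hcc' := hcc.mono hsub
  have hgs : ∀ y' ∈ D, Tendsto (fun x' => g x' y') (𝓝 x) (𝓝 (g x y')) := fun y' hy' =>
    (hgc'.comp (f := fun x' => (x', y')) (by fun_prop) fun x' hx' => ⟨hx', hy'⟩).continuousAt hN
  have hcs : ∀ y' ∈ D, Tendsto (fun x' => c x' y') (𝓝 x) (𝓝 (c x y')) := fun y' hy' =>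
    (hcc'.comp (f := fun x' => (x', y')) (by fun_prop) fun x' hx' => ⟨hx', hy'⟩).continuousAt hN
  obtain ⟨δ, hδ, hunif⟩ := eventually_uniform_slater ⟨y, hyD⟩ hcs hS
  obtain ⟨M, hM⟩ : ∃ M, ∀ q ∈ N ×ˢ D, ‖Function.uncurry g q‖ ≤ M :=
    ((isCompact_closedBall x r).prod hD).exists_bound_of_continuousOn hgc'
  have hsol : ∀ᶠ x' in 𝓝 x, ∃ q : F × H, q.1 ∈ D ∧ c x' q.1 ∈ K ∧ q.2 ∈ polarCone K ∧
      (∀ y' ∈ D, g x' y' - inner ℝ q.2 (c x' y') ≤ g x' q.1) ∧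
      q.2 ∈ Metric.closedBall (0 : H) (2 * M / δ) := by
    filter_upwards [hunif, hN, hg, hc] with x' hS' hx' hg' hc'
    obtain ⟨y₁, hy₁, hK₁, -, l₁, hl₁, hm₁⟩ := exists_isMaxOn_and_multiplier hK hKconv hKcone h0 hD
      (hg'.concaveOn.subset Set.inter_subset_left hDconv)
      (hgc'.comp (f := fun y' => (x', y')) (by fun_prop) fun y' hy' => ⟨hx', hy'⟩)
      (fun l hl => (hc' l hl).subset Set.inter_subset_left hDconv)
      (hcc'.comp (f := fun y' => (x', y')) (by fun_prop) fun y' hy' => ⟨hx', hy'⟩) hδ hS'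
    refine ⟨(y₁, l₁), hy₁, hK₁, hl₁, hm₁, ?_⟩
    -- At a Slater point the multiplier inequality reads `g x' y₂ + δ * ‖l₁‖ ≤ g x' y₁`, with both
    -- values of `g` bounded by `M`.
    rw [mem_closedBall_zero_iff, le_div_iff₀ hδ]
    obtain ⟨y₂, hy₂, hle⟩ := hS' l₁ hl₁
    have h₁ := hm₁ y₂ hy₂
    have h₂ := (abs_le.1 (hM (x', y₁) ⟨hx', hy₁⟩)).2
    have h₃ := (abs_le.1 (hM (x', y₂) ⟨hx', hy₂⟩)).1
    simp only [Function.uncurry_apply_pair] at h₂ h₃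
    simp only
    linarith
  have : Nonempty (F × H) := ⟨(0, 0)⟩
  obtain ⟨qf, hqf⟩ := hsol.choice
  obtain ⟨l, hl, hlm⟩ : ∃ l ∈ polarCone K, ∀ y' ∈ D, g x y' - inner ℝ l (c x y') ≤ g x y := by
    obtain ⟨hD₁, hK₁, hl₁, hm₁, -⟩ := hqf.self_of_nhds
    exact ⟨_, hl₁, fun y' hy' => (hm₁ y' hy').trans (hmax _ hD₁.1 hK₁)⟩
  have hlim : Tendsto qf (𝓝 x) (𝓝 (y, l)) := by
    -- The chosen pairs stay in a compact set, so it is enough that every cluster point is a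
    -- solution with a multiplier, hence equals `(y, l)`.
    refine (hD.prod (isCompact_closedBall (0 : H) (2 * M / δ))).tendsto_nhds_of_unique_mapClusterPt
      (hqf.mono fun x' h => ⟨h.1, h.2.2.2.2⟩) ?_
    rintro ⟨y₁, l₁⟩ ⟨hy₁, -⟩ hcl
    obtain ⟨U, hU, hUq⟩ := mapClusterPt_iff_ultrafilter.1 hcl
    have hUy : Tendsto (fun x' => (qf x').1) U (𝓝 y₁) := (continuous_fst.tendsto _).comp hUq
    have hUl : Tendsto (fun x' => (qf x').2) U (𝓝 l₁) := (continuous_snd.tendsto _).comp hUq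
    have hqU := hU hqf
    have hUND : Tendsto (fun x' => (x', (qf x').1)) U (𝓝[N ×ˢ D] (x, y₁)) := by
      refine tendsto_nhdsWithin_iff.2 ⟨Tendsto.prodMk_nhds hU hUy, ?_⟩
      filter_upwards [hU hN, hqU] with x' h₁ h₂
      exact ⟨h₁, h₂.1⟩
    have hUc : Tendsto (fun x' => c x' (qf x').1) U (𝓝 (c x y₁)) :=
      (hcc' (x, y₁) ⟨hxN, hy₁⟩).tendsto.comp hUND
    have hUg : Tendsto (fun x' => g x' (qf x').1) U (𝓝 (g x y₁)) :=
      (hgc' (x, y₁) ⟨hxN, hy₁⟩).tendsto.comp hUND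
    have hK₁ : c x y₁ ∈ K := hK.mem_of_tendsto hUc (by
      filter_upwards [hqU] with x' h using h.2.1)
    have hl₁ : l₁ ∈ polarCone K := (isClosed_polarCone K).mem_of_tendsto hUl (by
      filter_upwards [hqU] with x' h using h.2.2.1)
    have hm₁ : ∀ y' ∈ D, g x y' - inner ℝ l₁ (c x y') ≤ g x y₁ := fun y' hy' =>
      le_of_tendsto_of_tendsto (((hgs y' hy').mono_left hU).sub
        (hUl.inner ((hcs y' hy').mono_left hU))) hUg (by
        filter_upwards [hqU] with x' h using h.2.2.2.1 y' hy')
    have hge : g x y ≤ g x y₁ := by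
      have := hm₁ y hyD
      have := hl₁ _ hyK
      linarith
    have hyy : y₁ = y := by
      by_contra hne
      -- The midpoint of two distinct solutions would be feasible with a strictly larger value.
      have hmid : c x ((1 / 2 : ℝ) • y₁ + (1 / 2 : ℝ) • y) ∈ K := by
        have h₁ := sub_combo_mem_of_convexOn hK hKconv hKcone h0 hc.self_of_nhds hy₁.1 hyY
          (show (0 : ℝ) ≤ 1 / 2 by norm_num) (show (0 : ℝ) ≤ 1 / 2 by norm_num) (by norm_num)
        have h₂ := add_mem_of_cone hKconv hKcone h₁ (hKconv hK₁ hyK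
          (show (0 : ℝ) ≤ 1 / 2 by norm_num) (show (0 : ℝ) ≤ 1 / 2 by norm_num) (by norm_num))
        simpa using h₂
      have h₁ := hmax _ (hYconv hy₁.1 hyY (show (0 : ℝ) ≤ 1 / 2 by norm_num)
        (show (0 : ℝ) ≤ 1 / 2 by norm_num) (by norm_num)) hmid
      have h₂ := hg.self_of_nhds.2 hy₁.1 hyY hne (show (0 : ℝ) < 1 / 2 by norm_num)
        (show (0 : ℝ) < 1 / 2 by norm_num) (by norm_num)
      simp only [smul_eq_mul] at h₂
      linarith
    subst hyy
    rw [huniq l₁ hl₁ l hl hm₁ hlm]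
  refine ⟨l, hl, hlm, fun x' => (qf x').1, fun x' => (qf x').2,
    (continuous_fst.tendsto _).comp hlim, (continuous_snd.tendsto _).comp hlim, ?_⟩
  -- Once the solution on `D` is interior to the ball, it is a local maximum over the whole feasible
  -- set, hence global by concavity.
  have hball := ((continuous_fst.tendsto _).comp hlim).eventually (Metric.ball_mem_nhds y hr)
  filter_upwards [hqf, hball, hg, hc] with x' hq hb hg' hc'
  obtain ⟨hD₁, hK₁, hl₁, hm₁, -⟩ := hq
  refine ⟨hD₁, hK₁, hl₁, hm₁, fun y' hy' hK' => ?_⟩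
  have hfconv : Convex ℝ {y | y ∈ Y ∧ c x' y ∈ K} := by
    intro y₁ h₁ y₂ h₂ a b ha hb hab
    refine ⟨hYconv h₁.1 h₂.1 ha hb hab, ?_⟩
    have h₃ := sub_combo_mem_of_convexOn hK hKconv hKcone h0 hc' h₁.1 h₂.1 ha hb hab
    simpa using add_mem_of_cone hKconv hKcone h₃ (hKconv h₁.2 h₂.2 ha hb hab)
  have hloc : IsLocalMaxOn (g x') {y | y ∈ Y ∧ c x' y ∈ K} (qf x').1 := by
    filter_upwards [self_mem_nhdsWithin, mem_nhdsWithin_of_mem_nhds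
      (Metric.isOpen_ball.mem_nhds hb)] with y₂ h₂ hb₂
    have h₃ := hm₁ y₂ ⟨h₂.1, Metric.ball_subset_closedBall hb₂⟩
    have h₄ := hl₁ _ h₂.2
    linarith
  exact IsMaxOn.of_isLocalMaxOn_of_concaveOn (s := {y | y ∈ Y ∧ c x' y ∈ K}) ⟨hD₁.1, hK₁⟩ hloc
    (hg'.concaveOn.subset (fun y h => h.1) hfconv) ⟨hy', hK'⟩

end Stability

section Smooth

variable {V W : Type*} [NormedAddCommGroup V] [NormedSpace ℝ V]
    [NormedAddCommGroup W] [NormedSpace ℝ W]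

theorem LocallyLipschitzSmoothOn.exists_isOpen {f : V → W} {S : Set V}
    (hf : LocallyLipschitzSmoothOn f S) {x : V} (hx : x ∈ S) :
    ∃ O, IsOpen O ∧ x ∈ O ∧ ContinuousOn f O ∧ HasStrictFDerivAt f (fderiv ℝ f x) x := by
  obtain ⟨O, hO, hSO, hd, hl⟩ := hf
  have hxO := hO.mem_nhds (hSO hx)
  refine ⟨O, hO, hSO hx, hd.continuousOn,
    hasStrictFDerivAt_of_hasFDerivAt_of_continuousAt ?_ (hl.continuousOn.continuousAt hxO)⟩
  filter_upwards [hxO] with z hz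
  exact (hd.differentiableAt (hO.mem_nhds hz)).hasFDerivAt

end Smooth

/-! ### Consequences of nondegeneracy -/

section Nondegeneracy

variable {F H : Type*} [NormedAddCommGroup F] [InnerProductSpace ℝ F] [NormedAddCommGroup H]
  [InnerProductSpace ℝ H]

theorem mem_lin_prod {S : Set H} {T : Set F} {q : H × F} (hq : q ∈ lin (S ×ˢ T)) :
    (q.1 ∈ S ∧ -q.1 ∈ S) ∧ q.2 ∈ T ∧ -q.2 ∈ T := by
  obtain ⟨W, hW, hqW⟩ := hq
  have h₁ := hW hqW
  have h₂ := hW (W.neg_mem hqW)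
  exact ⟨⟨h₁.1, h₂.1⟩, h₁.2, h₂.2⟩

/-- Under nondegeneracy a covector annihilating the lineality spaces vanishes. -/
theorem eq_zero_of_nondegenerate {S : Set H} {T : Set F} {A : F →L[ℝ] H}
    (hnd : (Set.univ : Set (H × F)) = Set.range (fun d : F => (A d, d)) + lin (S ×ˢ T)) {l : H}
    (hS : ∀ u, u ∈ S → -u ∈ S → inner ℝ l u = 0)
    (hT : ∀ d, d ∈ T → -d ∈ T → inner ℝ l (A d) = 0) : l = 0 := by
  -- Decomposing `(l, 0)` writes `l` as `A d + q.1` with `d` and `q.1` in the lineality directions,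
  -- so `⟪l, l⟫ = 0`.
  have hmem : ((l, 0) : H × F) ∈ Set.range (fun d : F => (A d, d)) + lin (S ×ˢ T) :=
    hnd ▸ Set.mem_univ _
  obtain ⟨_, ⟨d, rfl⟩, q, hq, hsum⟩ := hmem
  obtain ⟨⟨h₁, h₂⟩, h₃, h₄⟩ := mem_lin_prod hq
  obtain ⟨e₁, e₂⟩ := Prod.mk.inj hsum
  have hd : d = -q.2 := eq_neg_of_add_eq_zero_left e₂
  have hAd : inner ℝ l (A d) = 0 := hT d (hd ▸ h₄) (by rwa [hd, neg_neg])
  have h : inner ℝ l l = (0 : ℝ) := by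
    nth_rw 2 [← e₁]
    rw [inner_add_right, hS _ h₁ h₂, hAd, add_zero]
  exact inner_self_eq_zero.1 h

/-- First order conditions satisfied by a Lagrange multiplier. -/
theorem kkt_of_multiplier {Y : Set F} {K : Set H} {g : F → ℝ} {c : F → H} {y : F}
    {g' : F →L[ℝ] ℝ} {c' : F →L[ℝ] H} {r : ℝ} (hr : 0 < r) (hg : HasFDerivAt g g' y)
    (hc : HasFDerivAt c c' y) (hyY : y ∈ Y) (hyK : c y ∈ K) {l : H} (hl : l ∈ polarCone K)
    (hm : ∀ y' ∈ Y ∩ Metric.closedBall y r, g y' - inner ℝ l (c y') ≤ g y) :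
    inner ℝ l (c y) = 0 ∧ (∀ u ∈ clarkeTangentCone K (c y), inner ℝ l u ≤ 0) ∧
      ∀ d ∈ clarkeTangentCone Y y, g' d - inner ℝ l (c' d) ≤ 0 := by
  have h0 : inner ℝ l (c y) = 0 := by
    have h₁ := hm y ⟨hyY, Metric.mem_closedBall_self hr.le⟩
    have h₂ := hl _ hyK
    linarith
  refine ⟨h0, fun u hu => ?_, fun d hd => ?_⟩
  · refine mem_clarkeNormalCone_of_forall_sub hyK (fun z hz => ?_) u hu
    rw [inner_sub_right, h0, sub_zero]
    exact hl z hz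
  · have hL : HasFDerivAt (fun y' => g y' - inner ℝ l (c y')) (g' - (innerSL ℝ l).comp c') y :=
      hg.sub ((innerSL ℝ l).hasFDerivAt.comp y hc)
    refine fderiv_nonpos_of_isLocalMaxOn hyY hL ?_ hd
    filter_upwards [self_mem_nhdsWithin, mem_nhdsWithin_of_mem_nhds
      (Metric.closedBall_mem_nhds y hr)] with y' h₁ h₂
    rw [h0, sub_zero]
    exact hm y' ⟨h₁, h₂⟩

/-- Along a direction tangent together with its negative, the first order inequalities become
equalities, so `l₁ - l₂` annihilates the lineality directions. -/
theorem multiplier_unique {Y : Set F} {K : Set H} {g : F → ℝ} {c : F → H} {y : F}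
    {g' : F →L[ℝ] ℝ} {c' : F →L[ℝ] H} {r : ℝ} (hr : 0 < r) (hg : HasFDerivAt g g' y)
    (hc : HasFDerivAt c c' y) (hyY : y ∈ Y) (hyK : c y ∈ K)
    (hnd : (Set.univ : Set (H × F)) = Set.range (fun d : F => (c' d, d)) +
      lin (clarkeTangentCone K (c y) ×ˢ clarkeTangentCone Y y)) {l₁ l₂ : H}
    (hl₁ : l₁ ∈ polarCone K) (hl₂ : l₂ ∈ polarCone K)
    (hm₁ : ∀ y' ∈ Y ∩ Metric.closedBall y r, g y' - inner ℝ l₁ (c y') ≤ g y)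
    (hm₂ : ∀ y' ∈ Y ∩ Metric.closedBall y r, g y' - inner ℝ l₂ (c y') ≤ g y) : l₁ = l₂ := by
  obtain ⟨-, hu₁, hd₁⟩ := kkt_of_multiplier hr hg hc hyY hyK hl₁ hm₁
  obtain ⟨-, hu₂, hd₂⟩ := kkt_of_multiplier hr hg hc hyY hyK hl₂ hm₂
  refine sub_eq_zero.1 (eq_zero_of_nondegenerate hnd (fun u h h' => ?_) fun d h h' => ?_)
  · have := hu₁ _ h
    have := hu₂ _ h
    have := hu₁ _ h'
    have := hu₂ _ h'
    simp only [inner_neg_right] at *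
    rw [inner_sub_left]
    linarith
  · have := hd₁ _ h
    have := hd₂ _ h
    have := hd₁ _ h'
    have := hd₂ _ h'
    simp only [map_neg, inner_neg_right] at *
    rw [inner_sub_left]
    linarith

/-- Nondegeneracy implies the Slater condition in dual form near the given point. -/
theorem exists_inner_neg_of_nondegenerate {Y : Set F} {K : Set H} {c : F → H} {y : F}
    {c' : F →L[ℝ] H} {r : ℝ} (hr : 0 < r) (hc : HasFDerivAt c c' y) (hyY : y ∈ Y) (hyK : c y ∈ K)
    (hnd : (Set.univ : Set (H × F)) = Set.range (fun d : F => (c' d, d)) +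
      lin (clarkeTangentCone K (c y) ×ˢ clarkeTangentCone Y y)) {l : H}
    (hl : l ∈ polarCone K) (hl0 : l ≠ 0) :
    ∃ y' ∈ Y ∩ Metric.closedBall y r, inner ℝ l (c y') < 0 := by
  -- Otherwise both `l` and `0` would be multipliers for the zero objective, against uniqueness.
  by_contra! hcon
  refine hl0 (multiplier_unique (g := fun _ => 0) (g' := 0) hr (hasFDerivAt_const 0 y) hc hyY hyK
    hnd hl (zero_mem_polarCone K) (fun y' hy' => ?_) fun y' hy' => ?_)
  · simpa using hcon y' hy'
  · simp

end Nondegeneracy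

/-! ### Equivalence of the two stationarity notions -/

section Main

variable {n m p : ℕ} {X : Set (EuclideanSpace ℝ (Fin n))} {Y : Set (EuclideanSpace ℝ (Fin p))}
  {K : Set (EuclideanSpace ℝ (Fin m))}
  {g : EuclideanSpace ℝ (Fin n) → EuclideanSpace ℝ (Fin p) → ℝ}
  {r₁ : EuclideanSpace ℝ (Fin n) → ℝ}
  {c : EuclideanSpace ℝ (Fin n) → EuclideanSpace ℝ (Fin p) → EuclideanSpace ℝ (Fin m)} {μ : ℝ}

theorem hasFDerivAt_left_of_uncurry {A B Z : Type*} [NormedAddCommGroup A] [NormedSpace ℝ A]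
    [NormedAddCommGroup B] [NormedSpace ℝ B] [NormedAddCommGroup Z] [NormedSpace ℝ Z]
    {f : A → B → Z} {f' : A × B →L[ℝ] Z} {a : A} {b : B}
    (hf : HasFDerivAt (Function.uncurry f) f' (a, b)) :
    HasFDerivAt (fun a' => f a' b) (f'.comp (ContinuousLinearMap.inl ℝ A B)) a :=
  hf.comp (f := fun a' => (a', b)) a (hasFDerivAt_prodMk_left a b)

theorem hasFDerivAt_right_of_uncurry {A B Z : Type*} [NormedAddCommGroup A] [NormedSpace ℝ A]
    [NormedAddCommGroup B] [NormedSpace ℝ B] [NormedAddCommGroup Z] [NormedSpace ℝ Z]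
    {f : A → B → Z} {f' : A × B →L[ℝ] Z} {a : A} {b : B}
    (hf : HasFDerivAt (Function.uncurry f) f' (a, b)) :
    HasFDerivAt (f a) (f'.comp (ContinuousLinearMap.inr ℝ A B)) b :=
  hf.comp (f := fun b' => (a, b')) b (hasFDerivAt_prodMk_right a b)

/-- At a solution of the inner problem there is exactly one Lagrange multiplier, and it yields the
Clarke subdifferential of the inner value function. -/
theorem StandingAssumptions.exists_multiplier (hA : StandingAssumptions X Y K g r₁ c μ)
    (hμ : 0 < μ) (hY : IsClosed Y) (hK : IsClosed K) (hKconv : Convex ℝ K)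
    (hKcone : ∀ z ∈ K, ∀ t : ℝ, 0 ≤ t → t • z ∈ K) {x : EuclideanSpace ℝ (Fin n)}
    {y : EuclideanSpace ℝ (Fin p)} (hx : x ∈ X) (hy : y ∈ innerArgmax Y K g r₁ c x) :
    ∃ r > 0, ∃ l ∈ polarCone K,
      (∀ y' ∈ Y ∩ Metric.closedBall y r, g x y' - inner ℝ l (c x y') ≤ g x y) ∧
      (∀ l' ∈ polarCone K, (∀ y' ∈ Y, g x y' - inner ℝ l' (c x y') ≤ g x y) → l' = l) ∧
      clarkeSubdifferential (innerValue Y K g r₁ c) x =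
        {gradient (fun x' => g x' y) x -
          ContinuousLinearMap.adjoint (fderiv ℝ (fun x' => c x' y) x) l} +
          clarkeSubdifferential r₁ x := by
  obtain ⟨⟨hyY, hyK⟩, hmax⟩ := hy
  have hmax' : ∀ y' ∈ Y, c x y' ∈ K → g x y' ≤ g x y := fun y' h₁ h₂ => by
    have : g x y' + r₁ x ≤ g x y + r₁ x := hmax ⟨h₁, h₂⟩
    linarith
  obtain ⟨Og, hOg, hxyg, hgO, hgs⟩ := hA.g_smooth.exists_isOpen (Set.mk_mem_prod hx hyY)
  obtain ⟨Oc, hOc, hxyc, hcO, hcs⟩ := hA.c_smooth.exists_isOpen (Set.mk_mem_prod hx hyY)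
  obtain ⟨r, hr, hball⟩ := Metric.nhds_basis_closedBall.mem_iff.1
    (inter_mem (hOg.mem_nhds hxyg) (hOc.mem_nhds hxyc))
  rw [← closedBall_prod_same] at hball
  have hgy := hasFDerivAt_right_of_uncurry hgs.hasFDerivAt
  have hcy := hasFDerivAt_right_of_uncurry hcs.hasFDerivAt
  have hnd := hA.nondegenerate x hx y hyY hyK
  rw [hcy.fderiv] at hnd
  obtain ⟨l, hl, hlm, yf, lf, hyf, hlf, hev⟩ := exists_tendsto_solution_multiplier hY hK hKconv
    hKcone hr (hgO.mono (hball.trans Set.inter_subset_left))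
    (hcO.mono (hball.trans Set.inter_subset_right))
    ((hA.g_strongConcave.filter_mono (nhds_le_nhdsSet hx)).mono fun x' h => h.strictConcaveOn hμ)
    (hA.c_convex.filter_mono (nhds_le_nhdsSet hx)) hyY hyK hmax'
    (fun l hl hl0 => exists_inner_neg_of_nondegenerate hr hcy hyY hyK hnd hl hl0)
    (fun l₁ h₁ l₂ h₂ => multiplier_unique hr hgy hcy hyY hyK hnd h₁ h₂)
  refine ⟨r, hr, l, hl, hlm, fun l' hl' hm' => multiplier_unique hr hgy hcy hyY hyK hnd hl' hl
    (fun y' hy' => hm' y' hy'.1) hlm, ?_⟩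
  have hvalue : ∀ᶠ x' in 𝓝 x, innerValue Y K g r₁ c x' - r₁ x' = g x' (yf x') := by
    filter_upwards [hev] with x' h
    obtain ⟨hD, hK', -, -, hmx⟩ := h
    have hgr : IsGreatest ((fun y => g x' y + r₁ x') '' feasibleSet Y K c x')
        (g x' (yf x') + r₁ x') := by
      refine ⟨⟨yf x', ⟨hD.1, hK'⟩, rfl⟩, ?_⟩
      rintro _ ⟨y', ⟨h₁, h₂⟩, rfl⟩
      have := hmx y' h₁ h₂
      simp only
      linarith
    rw [innerValue, hgr.csSup_eq, add_sub_cancel_right]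
  have hstrict := hasStrictFDerivAt_envelope (K := K) (D := Y ∩ Metric.closedBall y r)
    (h := fun z => innerValue Y K g r₁ c z - r₁ z) hgs hcs hyf hlf (by
      filter_upwards [hvalue, hev] with x' h₁ h₂
      simp only [h₁]
      exact ⟨trivial, h₂.1, h₂.2.1, h₂.2.2.1, h₂.2.2.2.1⟩)
  refine clarkeSubdifferential_eq_singleton_add hA.r₁_lipschitz ?_
  convert hstrict using 1
  ext v
  rw [innerSL_apply_apply, inner_sub_left, inner_gradient_left,
    ContinuousLinearMap.adjoint_inner_left,
    (hasFDerivAt_left_of_uncurry hgs.hasFDerivAt).fderiv,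
    (hasFDerivAt_left_of_uncurry hcs.hasFDerivAt).fderiv]
  simp

theorem StandingAssumptions.differentiableAt_right (hA : StandingAssumptions X Y K g r₁ c μ)
    {x : EuclideanSpace ℝ (Fin n)} {y : EuclideanSpace ℝ (Fin p)} (hx : x ∈ X) (hy : y ∈ Y) :
    DifferentiableAt ℝ (g x) y ∧ DifferentiableAt ℝ (c x) y := by
  obtain ⟨_, -, -, -, hgs⟩ := hA.g_smooth.exists_isOpen (Set.mk_mem_prod hx hy)
  obtain ⟨_, -, -, -, hcs⟩ := hA.c_smooth.exists_isOpen (Set.mk_mem_prod hx hy)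
  exact ⟨(hasFDerivAt_right_of_uncurry hgs.hasFDerivAt).differentiableAt,
    (hasFDerivAt_right_of_uncurry hcs.hasFDerivAt).differentiableAt⟩

theorem zero_mem_singleton_neg_add_iff {V : Type*} [AddCommGroup V] {a : V} {S : Set V} :
    0 ∈ {-a} + S ↔ a ∈ S := by
  simp [Set.singleton_add]

theorem IsFirstOrderMinimaxMCC.exists_MOL (hA : StandingAssumptions X Y K g r₁ c μ)
    (hμ : 0 < μ) (hY : IsClosed Y) (hK : IsClosed K) (hKconv : Convex ℝ K)
    (hKcone : ∀ z ∈ K, ∀ t : ℝ, 0 ≤ t → t • z ∈ K) {x : EuclideanSpace ℝ (Fin n)}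
    {y : EuclideanSpace ℝ (Fin p)} (h : IsFirstOrderMinimaxMCC X Y K g r₁ c x y) :
    ∃ l ∈ polarCone K, IsFirstOrderMinimaxMOL X Y K g r₁ c x l y := by
  obtain ⟨hx, hyY, hstat, hmax⟩ := h
  have hyK := hmax.1.2
  have h0 : (0 : EuclideanSpace ℝ (Fin m)) ∈ K := by simpa using hKcone _ hyK 0 le_rfl
  obtain ⟨r, hr, l, hl, hlm, -, hsub⟩ := hA.exists_multiplier hμ hY hK hKconv hKcone hx hmax
  obtain ⟨hgd, hcd⟩ := hA.differentiableAt_right hx hyY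
  obtain ⟨hcomp, -, hd⟩ := kkt_of_multiplier hr hgd.hasFDerivAt hcd.hasFDerivAt hyY hyK hl hlm
  refine ⟨l, hl, hx, hl, hyY, hsub ▸ hstat, ?_, ?_⟩
  · rw [neg_add_eq_sub, ← neg_sub, zero_mem_singleton_neg_add_iff]
    intro d hdT
    rw [inner_sub_left, inner_gradient_left, ContinuousLinearMap.adjoint_inner_left]
    exact hd d hdT
  · rw [zero_mem_singleton_neg_add_iff]
    exact (mem_clarkeNormalCone_polarCone_iff hK hKconv hKcone h0 hl).2 ⟨hyK, hcomp⟩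

theorem IsFirstOrderMinimaxMOL.toMCC (hA : StandingAssumptions X Y K g r₁ c μ)
    (hμ : 0 < μ) (hY : IsClosed Y) (hK : IsClosed K) (hKconv : Convex ℝ K)
    (hKcone : ∀ z ∈ K, ∀ t : ℝ, 0 ≤ t → t • z ∈ K) {x : EuclideanSpace ℝ (Fin n)}
    {l : EuclideanSpace ℝ (Fin m)} {y : EuclideanSpace ℝ (Fin p)}
    (h : IsFirstOrderMinimaxMOL X Y K g r₁ c x l y) : IsFirstOrderMinimaxMCC X Y K g r₁ c x y := by
  obtain ⟨hx, hl, hyY, hstat, hny, hnl⟩ := h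
  -- `K` is not known to be nonempty before complementarity is used; the Slater point supplies an
  -- element.
  have h0 : (0 : EuclideanSpace ℝ (Fin m)) ∈ K := by
    obtain ⟨y₀, -, -, hy₀⟩ := hA.slater x hx
    simpa using hKcone _ (intrinsicInterior_subset hy₀) 0 le_rfl
  rw [zero_mem_singleton_neg_add_iff] at hnl
  rw [neg_add_eq_sub, ← neg_sub, zero_mem_singleton_neg_add_iff] at hny
  obtain ⟨hyK, hcomp⟩ := (mem_clarkeNormalCone_polarCone_iff hK hKconv hKcone h0 hl).1 hnl
  obtain ⟨hgd, hcd⟩ := hA.differentiableAt_right hx hyY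
  have hgconc : ConcaveOn ℝ Y (g x) :=
    ((hA.g_strongConcave.self_of_nhdsSet x hx).strictConcaveOn hμ).concaveOn
  have hLconc : ConcaveOn ℝ Y (fun y' => g x y' - inner ℝ l (c x y')) :=
    hgconc.sub (hA.c_convex.self_of_nhdsSet x hx l hl)
  have hL : HasFDerivAt (fun y' => g x y' - inner ℝ l (c x y'))
      (fderiv ℝ (g x) y - (innerSL ℝ l).comp (fderiv ℝ (c x) y)) y :=
    hgd.hasFDerivAt.sub ((innerSL ℝ l).hasFDerivAt.comp y hcd.hasFDerivAt)
  -- Concavity turns stationarity of the Lagrangian into global maximality at `y`, where by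
  -- complementarity its value is `g x y`.
  have hm : ∀ y' ∈ Y, g x y' - inner ℝ l (c x y') ≤ g x y := by
    intro y' hy'
    have h₁ := sub_le_fderiv_of_concaveOn hLconc hyY hy' hL
    have h₂ := inner_sub_nonpos_of_mem_clarkeNormalCone hgconc.1 hny hy'
    rw [inner_sub_left, inner_gradient_left, ContinuousLinearMap.adjoint_inner_left] at h₂
    simp only [sub_apply, ContinuousLinearMap.comp_apply, innerSL_apply_apply] at h₁
    linarith
  have hmax : y ∈ innerArgmax Y K g r₁ c x := by
    refine ⟨⟨hyY, hyK⟩, fun y' hy' => ?_⟩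
    have h₁ := hm y' hy'.1
    have h₂ := hl _ hy'.2
    simp only [Set.mem_ofPred_eq]
    linarith
  -- The given `l` is a multiplier, so it is the one in the subdifferential formula.
  obtain ⟨r, hr, l₀, hl₀, -, huniq, hsub⟩ := hA.exists_multiplier hμ hY hK hKconv hKcone hx hmax
  refine ⟨hx, hyY, ?_, hmax⟩
  rw [hsub, ← huniq l hl hm]
  exact hstat

end Main

end MinimaxCoupled

theorem mainTheorem1 (n m p : ℕ)
    (X : Set (EuclideanSpace ℝ (Fin n))) (hX : IsClosed X)
    (Y : Set (EuclideanSpace ℝ (Fin p))) (hY : IsClosed Y) (hYconv : Convex ℝ Y)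
    (K : Set (EuclideanSpace ℝ (Fin m))) (hK : IsClosed K) (hKconv : Convex ℝ K)
    (hKcone : ∀ z ∈ K, ∀ t : ℝ, 0 ≤ t → t • z ∈ K)
    (g : EuclideanSpace ℝ (Fin n) → EuclideanSpace ℝ (Fin p) → ℝ)
    (r₁ : EuclideanSpace ℝ (Fin n) → ℝ)
    (c : EuclideanSpace ℝ (Fin n) → EuclideanSpace ℝ (Fin p) → EuclideanSpace ℝ (Fin m))
    (μ : ℝ) (hμ : 0 < μ)
    (hA : MinimaxCoupled.StandingAssumptions X Y K g r₁ c μ) :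
    (∀ x y, MinimaxCoupled.IsFirstOrderMinimaxMCC X Y K g r₁ c x y →
      ∃ l ∈ MinimaxCoupled.polarCone K,
        MinimaxCoupled.IsFirstOrderMinimaxMOL X Y K g r₁ c x l y) ∧
    (∀ x l y, MinimaxCoupled.IsFirstOrderMinimaxMOL X Y K g r₁ c x l y →
      MinimaxCoupled.IsFirstOrderMinimaxMCC X Y K g r₁ c x y) :=
  ⟨fun _ _ h => h.exists_MOL hA hμ hY hK hKconv hKcone,
    fun _ _ _ h => h.toMCC hA hμ hY hK hKconv hKcone⟩
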